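/- **Theorem.** Let $n\in\mathbb Z$ and let $K_n=C(2n,4)$ be the two-bridge knot (the unknot for $n=0$) that has a diagram with two twist regions, of $2|n|$ and of $4$ crossings, in both of which the two strands run in opposite directions; the four crossings of the second region are positive, those of the first region are negative if $n>0$ (the diagram is then alternating) and positive if $n<0$. Let $\mu,\lambda\in\pi_1(S^3\setminus K_n)$ be a meridian and the null-homologous longitude commuting with it. Let $E_n\subset(\mathbb C^*)^2$ be the set of all pairs $(L,M)$ for which there is a representation $\rho:\pi_1(S^3\setminus K_n)\to \mathrm{SL}(2,\mathbb C)$ such that $\rho(\lambda)$, $\rho(\mu)$ are upper triangular with upper left entries $L$, $M$, and let $E_n^{\mathrm{na}}\subset E_n$ be the set of those pairs that come from some $\rho$ with non-abelian image. For $E\subset\mathbb C^2$ let $D(E)$ be the union of the one-dimensional irreducible components of the Zariski closure of $E$ in $\mathbb C^2$. We say that $A\in\mathbb Z[L,M]$ defines $D(E)$ up to repeated factors if the coefficients of $A$ are coprime and the irreducible factors of $A$ in $\mathbb C[L,M]$ are, up to constants, exactly the irreducible polynomials that define the components of $D(E)$. The polynomial that defines $D(E_n)$ is the $A$-polynomial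 of $K_n$ of Cooper–Culler–Gillet–Long–Shalen (including the factor $L-1$, which comes from the abelian representations); the one that defines $D(E_n^{\mathrm{na}})$ is the $A$-polynomial with the usual convention that this factor is omitted. For $n\ge 0$ put $$\begin{aligned}p_{2n}(z)=\sum_{i=0}^{2n}&\binom{\lfloor\frac i2\rfloor+n}{i}\,2^{-2\lfloor\frac{i+1}2\rfloor-i}\,(M^2)^{-\lfloor\frac i2\rfloor-2\lfloor\frac{i+1}2\rfloor+i+n}\,(LM^2+1)^{-2\lfloor\frac{i+1}2\rfloor-i+2n}\\&\times(-2LM^6+LM^4-LM^2-M^4+M^2z+M^2-2)^{\lfloor\frac{i+1}2\rfloor}\,(LM^2+L+M^2+z+1)^i\\&\times(-3LM^2+L+M^2+z-3)^{\lfloor\frac{i-1}2\rfloor}\,\bigl((-1)^{i+1}(LM^2+1)-2LM^2+L+M^2+z-2\bigr),\end{aligned}$$ and for $n<0$ put $$\begin{aligned}p_{2n}(z)=\sum_{i=0}^{-2n}&\binom{\lfloor\frac{i-1}2\rfloor-n}{i}\,2^{-2\lfloor\frac{i+1}2\rfloor-i}\,(M^2)^{-\lfloor\frac i2\rfloor-2\lfloor\frac{i+1}2\rfloor+i-n}\,(LM^2+1)^{-\frac12-2\lfloor\frac{i+1}2\rfloor-i-2n}\\&\times(-2LM^6+LM^4-LM^2-M^4+M^2z+M^2-2)^{\lfloor\frac{i+1}2\rfloor}\,(LM^2+L+M^2+z+1)^i\\&\times(-3LM^2+L+M^2+z-3)^{\lfloor\frac{i-1}2\rfloor}\,\bigl((-1)^{i}(-2LM^2+L+M^2+z-2)-LM^2-1\bigr).\end{aligned}$$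 Let $u=\sqrt{5L^2M^4-2L^2M^2+L^2-2LM^4+12LM^2-2L+M^4-2M^2+5}$; $u$ and $(LM^2+1)^{1/2}$ are taken in an algebraic closure of $\mathbb Q(L,M)$, with any choice of the roots (the same choice of $(LM^2+1)^{1/2}$ in both factors of the product below). Then $A_{2n}=p_{2n}(u)\,p_{2n}(-u)$ is a polynomial in $\mathbb Z[L,M]$ that does not depend on the choice of the roots. It is divisible by none of $L$, $M$, $LM^2+1$, $L-1$. Up to repeated factors, $A_{2n}$ defines $D(E_n^{\mathrm{na}})$ and $(L-1)A_{2n}$ defines $D(E_n)$; that is, $A_{2n}$ has exactly the irreducible factors of the $A$-polynomial of $C(2n,4)$, the factor $L-1$ of the abelian representations being omitted. -/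

import Mathlib

open MvPolynomial

noncomputable section

/-! ### Knot diagrams, knot groups, peripheral elements -/

/-- A signed Gauss code of an oriented knot diagram. Walking once along the knot from a base point one
meets the crossings at `2 * crossings` passes, numbered cyclically by `ZMod (2 * crossings)`. Crossing
`c` is met once on the upper strand, at the pass `overAt c`, and once on the lower strand, at the pass
`underAt c`; `sign c` is the usual sign of the crossing (`1` for a right-handed one). -/
structure SignedGaussCode where
  crossings : ℕ
  overAt : Fin crossings → ZMod (2 * crossings)
  underAt : Fin crossings → ZMod (2 * crossings)
  sign : Fin crossings → ℤˣ
  passes : Function.Bijective (Sum.elim overAt underAt)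

namespace SignedGaussCode

variable (D : SignedGaussCode)

/-- The Wirtinger relators. The generator `k` is the meridian of the edge that runs into the pass `k`,
so the edge that leaves the pass `k` is `k + 1`. At a crossing the upper strand keeps its meridian `y`,
and the meridian `x` of the lower strand becomes `y⁻¹ x y` at a positive and `y x y⁻¹` at a negative
crossing. -/
def wirtingerRels : Set (FreeGroup (ZMod (2 * D.crossings))) :=
  {r | ∃ c : Fin D.crossings,
    r = (FreeGroup.of (D.overAt c + 1))⁻¹ * FreeGroup.of (D.overAt c) ∨
    r = (FreeGroup.of (D.underAt c + 1))⁻¹ *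
      (FreeGroup.of (D.overAt c) ^ (-(D.sign c : ℤ)) * FreeGroup.of (D.underAt c) *
        FreeGroup.of (D.overAt c) ^ (D.sign c : ℤ))}

/-- The knot group, i.e. the fundamental group of the knot exterior, by its Wirtinger presentation. -/
abbrev knotGroup : Type := PresentedGroup D.wirtingerRels

/-- The meridian of the edge `k`. -/
def edgeMeridian (k : ZMod (2 * D.crossings)) : D.knotGroup := PresentedGroup.of k

/-- The meridian at the base point. -/
def meridian : D.knotGroup := D.edgeMeridian 0

/-- The contribution of the pass `k` to the blackboard longitude: nothing at an overpass; at an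
underpass, the meridian of the upper strand, to the power of the sign of the crossing. -/
def passFactor (k : ZMod (2 * D.crossings)) : D.knotGroup :=
  match (Equiv.ofBijective _ D.passes).symm k with
  | Sum.inl _ => 1
  | Sum.inr c => D.edgeMeridian (D.overAt c) ^ (D.sign c : ℤ)

def writhe : ℤ := ∑ c, (D.sign c : ℤ)

/-- The null-homologous longitude that commutes with `meridian`: the blackboard longitude, corrected
by a power of the meridian. -/
def longitude : D.knotGroup :=
  ((List.range (2 * D.crossings)).map fun k : ℕ => D.passFactor k).prod * D.meridian ^ (-D.writhe)

/-! ### The eigenvalue variety and the A-polynomial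

Points `v` of the plane `Fin 2 → ℂ` have the coordinates `L = v 0` and `M = v 1`. -/

/-- `v = (L, M)` is the pair of the upper left entries of `ρ(longitude)` and `ρ(meridian)`, both
of which are upper triangular. -/
def IsEigenvaluePair (ρ : D.knotGroup →* Matrix.SpecialLinearGroup (Fin 2) ℂ) (v : Fin 2 → ℂ) : Prop :=
  ρ D.longitude 1 0 = 0 ∧ ρ D.meridian 1 0 = 0 ∧ ρ D.longitude 0 0 = v 0 ∧ ρ D.meridian 0 0 = v 1

/-- The pairs `(L, M)` of all representations of the knot group in `SL(2, ℂ)`. -/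
def eigenvaluePairs : Set (Fin 2 → ℂ) :=
  {v | ∃ ρ : D.knotGroup →* Matrix.SpecialLinearGroup (Fin 2) ℂ, D.IsEigenvaluePair ρ v}

/-- The pairs `(L, M)` of the representations with non-abelian image. -/
def nonabelianEigenvaluePairs : Set (Fin 2 → ℂ) :=
  {v | ∃ ρ : D.knotGroup →* Matrix.SpecialLinearGroup (Fin 2) ℂ,
    (∃ g h, ρ g * ρ h ≠ ρ h * ρ g) ∧ D.IsEigenvaluePair ρ v}

end SignedGaussCode

/-- The irreducible polynomial `F` defines a one-dimensional irreducible component of the Zariski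
closure of `E` in `ℂ²`: the irreducible components of the closure correspond to the minimal primes
of the vanishing ideal of `E`, and the prime ideals of plane curves are the ideals `(F)`. -/
def IsCurveComponent (E : Set (Fin 2 → ℂ)) (F : MvPolynomial (Fin 2) ℂ) : Prop :=
  Irreducible F ∧ Ideal.span {F} ∈ (vanishingIdeal ℂ E).minimalPrimes

/-- Up to repeated factors, `A` is the defining polynomial, with coprime integer coefficients, of the
union of the one-dimensional irreducible components of the Zariski closure of `E`. -/
def DefinesCurvePart (E : Set (Fin 2 → ℂ)) (A : MvPolynomial (Fin 2) ℤ) : Prop :=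
  (∀ c : ℤ, C c ∣ A → IsUnit c) ∧
    ∀ F : MvPolynomial (Fin 2) ℂ, Irreducible F →
      (F ∣ map (Int.castRingHom ℂ) A ↔ IsCurveComponent E F)

/-! ### The knot `C(2n, 4)`

The diagram has two twist regions: one with the `2|n|` crossings `0, …, 2|n| - 1` and one with the
four crossings `2|n|, …, 2|n| + 3`. In both of them the two strands run in opposite directions. The
knot runs through the first region forwards, through the second one forwards, through the first one
backwards and through the second one backwards. Within each region the strand that comes first
passes over and under alternately. For `n > 0` the diagram is alternating, for `n < 0` the crossings
of the first region are switched. -/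

namespace ConwayKnot

/-- The number of crossings in the first twist region. -/
def k (n : ℤ) : ℕ := 2 * n.natAbs

/-- The crossings are numbered in the order in which they are first met. -/
def firstPass (n : ℤ) (c : Fin (k n + 4)) : ℕ := c

def secondPass (n : ℤ) (c : Fin (k n + 4)) : ℕ :=
  if (c : ℕ) < k n then 2 * k n + 3 - c else 3 * k n + 7 - c

/-- The crossing `c` is first met on the upper strand. -/
def FirstIsOver (n : ℤ) (c : Fin (k n + 4)) : Prop :=
  if (c : ℕ) < k n then (Even (c : ℕ) ↔ 0 < n) else Even (c : ℕ)

open Classical in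
def overPass (n : ℤ) (c : Fin (k n + 4)) : ℕ :=
  if FirstIsOver n c then firstPass n c else secondPass n c

open Classical in
def underPass (n : ℤ) (c : Fin (k n + 4)) : ℕ :=
  if FirstIsOver n c then secondPass n c else firstPass n c

theorem pass_inj (n : ℤ) : Function.Injective
    (Sum.elim (fun c => (overPass n c : ZMod (2 * (k n + 4))))
      (fun c => (underPass n c : ZMod (2 * (k n + 4))))) := by
  have hcast : ∀ a b : ℕ, a < 2 * (k n + 4) → b < 2 * (k n + 4) →
      (a : ZMod (2 * (k n + 4))) = b → a = b := by
    intro a b ha hb h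
    rw [ZMod.natCast_eq_natCast_iff] at h
    exact Nat.ModEq.eq_of_lt_of_lt h ha hb
  have ho : ∀ c, overPass n c < 2 * (k n + 4) := by
    intro c; have := c.2
    unfold overPass firstPass secondPass; split_ifs <;> omega
  have hu : ∀ c, underPass n c < 2 * (k n + 4) := by
    intro c; have := c.2
    unfold underPass firstPass secondPass; split_ifs <;> omega
  rintro (c | c) (d | d) h <;> have hc := c.2 <;> have hd := d.2
  · have := hcast _ _ (ho c) (ho d) h
    congr 1; ext
    unfold overPass firstPass secondPass at this; split_ifs at this <;> omega
  · exfalso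
    have h' := hcast _ _ (ho c) (hu d) h
    by_cases e : c = d
    · subst e
      unfold overPass underPass firstPass secondPass at h'; split_ifs at h' <;> omega
    · have e' : (c : ℕ) ≠ d := fun q => e (Fin.ext q)
      unfold overPass underPass firstPass secondPass at h'; split_ifs at h' <;> omega
  · exfalso
    have h' := hcast _ _ (hu c) (ho d) h
    by_cases e : c = d
    · subst e
      unfold overPass underPass firstPass secondPass at h'; split_ifs at h' <;> omega
    · have e' : (c : ℕ) ≠ d := fun q => e (Fin.ext q)
      unfold overPass underPass firstPass secondPass at h'; split_ifs at h' <;> omega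
  · have := hcast _ _ (hu c) (hu d) h
    congr 1; ext
    unfold underPass firstPass secondPass at this; split_ifs at this <;> omega

/-- The knot with Conway's notation `C(2n, 4)`. -/
def knot (n : ℤ) : SignedGaussCode where
  crossings := k n + 4
  overAt c := overPass n c
  underAt c := underPass n c
  sign c := if (c : ℕ) < k n ∧ 0 < n then -1 else 1
  passes := by
    rw [Fintype.bijective_iff_injective_and_card]
    refine ⟨pass_inj n, ?_⟩
    simp [ZMod.card]
    omega

end ConwayKnot

/-! ### The explicit formula -/

/-- `p_{2n}(z)`, over a field with elements `L`, `M` and a square root `r` of `L M² + 1`, so that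
`(L M² + 1) ^ (-1/2 + e)` is `r ^ (-1 + 2e)`. Division of integers rounds down. -/
def pFormula {K : Type*} [Field K] (n : ℤ) (L M r z : K) : K :=
  if 0 ≤ n then
    ∑ i ∈ Finset.range ((2 * n).toNat + 1),
      ((Ring.choose ((i : ℤ) / 2 + n) i : ℤ) : K)
      * 2 ^ (-2 * (((i : ℤ) + 1) / 2) - i)
      * (M ^ 2) ^ (-((i : ℤ) / 2) - 2 * (((i : ℤ) + 1) / 2) + i + n)
      * (L * M ^ 2 + 1) ^ (-2 * (((i : ℤ) + 1) / 2) - i + 2 * n)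
      * (-2 * L * M ^ 6 + L * M ^ 4 - L * M ^ 2 - M ^ 4 + M ^ 2 * z + M ^ 2 - 2)
          ^ (((i : ℤ) + 1) / 2)
      * (L * M ^ 2 + L + M ^ 2 + z + 1) ^ i
      * (-3 * L * M ^ 2 + L + M ^ 2 + z - 3) ^ (((i : ℤ) - 1) / 2)
      * ((-1) ^ (i + 1) * (L * M ^ 2 + 1) - 2 * L * M ^ 2 + L + M ^ 2 + z - 2)
  else
    ∑ i ∈ Finset.range ((-2 * n).toNat + 1),
      ((Ring.choose (((i : ℤ) - 1) / 2 - n) i : ℤ) : K)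
      * 2 ^ (-2 * (((i : ℤ) + 1) / 2) - i)
      * (M ^ 2) ^ (-((i : ℤ) / 2) - 2 * (((i : ℤ) + 1) / 2) + i - n)
      * r ^ (-1 + 2 * (-2 * (((i : ℤ) + 1) / 2) - i - 2 * n))
      * (-2 * L * M ^ 6 + L * M ^ 4 - L * M ^ 2 - M ^ 4 + M ^ 2 * z + M ^ 2 - 2)
          ^ (((i : ℤ) + 1) / 2)
      * (L * M ^ 2 + L + M ^ 2 + z + 1) ^ i
      * (-3 * L * M ^ 2 + L + M ^ 2 + z - 3) ^ (((i : ℤ) - 1) / 2)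
      * ((-1) ^ i * (-2 * L * M ^ 2 + L + M ^ 2 + z - 2) - L * M ^ 2 - 1)

/-- The radicand: `u` is a square root of it. -/
def uSquared {K : Type*} [Field K] (L M : K) : K :=
  5 * L ^ 2 * M ^ 4 - 2 * L ^ 2 * M ^ 2 + L ^ 2 - 2 * L * M ^ 4 + 12 * L * M ^ 2 - 2 * L
    + M ^ 4 - 2 * M ^ 2 + 5

/-- The ring `ℤ[L, M]`, with `L = X 0` and `M = X 1`. -/
abbrev PolyLM : Type := MvPolynomial (Fin 2) ℤ

/-- An algebraic closure of the field of fractions of `ℤ[L, M]`, in which the square roots live. -/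
abbrev AlgFun : Type := AlgebraicClosure (FractionRing PolyLM)

/-- `L` and `M` as algebraic functions. -/
def Lfun : AlgFun := algebraMap PolyLM AlgFun (X 0)

def Mfun : AlgFun := algebraMap PolyLM AlgFun (X 1)

end

/-! The knot group is generated by two meridians `a`, `c` with the single relation `c * R ^ n = R ^
n * a`, where `S = c * a⁻¹` and `R = a⁻¹ * S ^ 2 * a * (S ^ 2)⁻¹`; the longitude is the commutator
`Λ = R ^ (-n) * S ^ (-2) * R ^ n * S ^ 2`. Both facts are read off the diagram, since passing two
crossings of a twist region conjugates the meridians by a fixed element (`relation_of_isColoring`,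
`longitude_eq`). In `SL(2)` let `M` be an eigenvalue of `a` and `y` the trace of `S`. By
Cayley–Hamilton `R ^ n` is a combination of `R` and `1` with Chebyshev coefficients, and `c * R - R
* a` is a scalar multiple of `c - a`. For `c ≠ a` the relation is therefore one equation in `M` and
`y`, the vanishing of the Riley polynomial (`relation_iff`). Once it holds, the first columns of `S
^ 2 * R ^ n * Λ = R ^ n * S ^ 2` give a quadratic equation for `y` over `ℤ[L, M ^ 2]` in which `n`
no longer occurs (`longitude_relation`, `quadratic_eq`). Its discriminant is `u ^ 2`, so eliminating
`y` means multiplying the values of the Riley polynomial at the two roots, which belong to `u` and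
`-u`. Expanded in powers of `tr R - 2`, the Chebyshev polynomials become the binomial sums of
`p_{2n}` (`pFormula_eq`). Hence `A` is a resultant, `curvePoly`. It remains to compare the curve `A
= 0` with the eigenvalue pairs. Nonabelian representations give points of the curve, except perhaps
when `M ^ 2 = 1`; then `L ^ 2 = 1` too, which leaves finitely many points. Conversely every point of
the curve off `M = 0`, `M ^ 4 = 1` and `L * M ^ 2 + 1 = 0` comes from a nonabelian representation.
No component of the curve is one of these excluded ones, as the eliminant is nonzero at a suitable
point of each. `definesCurvePart_of` turns this into the statement on minimal primes; the value `1`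
of `A` at `(0, 1)` makes its coefficients coprime. -/

noncomputable section

/-! ### The Riley polynomial -/

namespace Riley

section Ring

variable {R S : Type*} [CommRing R] [CommRing S]

/-- Homogenized Chebyshev polynomials: for `κ = m * t` the first component is
`m ^ n * (S_n - S_{n-1})(t + 2)` and the second one, times `m`, is `m ^ n * S_{n-1}(t + 2)`. -/
def chebPair (m κ : R) : ℕ → R × R
  | 0 => (1, 0)
  | n + 1 => (m * (chebPair m κ n).1 + κ * (m * (chebPair m κ n).2 + (chebPair m κ n).1),
      m * (chebPair m κ n).2 + (chebPair m κ n).1)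

theorem map_chebPair (f : R →+* S) (m κ : R) (n : ℕ) :
    f (chebPair m κ n).1 = (chebPair (f m) (f κ) n).1 ∧
      f (chebPair m κ n).2 = (chebPair (f m) (f κ) n).2 := by
  induction n with
  | zero => simp [chebPair]
  | succ n ih => simp [chebPair, ih.1, ih.2]

/-- With `m = M ^ 2` this is `m * (y + 2 - (M + M⁻¹) ^ 2)`. -/
def base (m y : R) : R := m * y - m ^ 2 - 1

/-- The Riley polynomial of `C(2n, 4)` times `m ^ |n|`, where `m = M ^ 2`, as a function of the trace
`y` of the product of a meridian and an inverse meridian. -/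
def riley (n : ℤ) (m y : R) : R :=
  if 0 ≤ n then
    (chebPair m (base m y * y ^ 2 * (y - 2)) n.toNat).1 +
      base m y * y * (y - 1) * (chebPair m (base m y * y ^ 2 * (y - 2)) n.toNat).2
  else
    m * (chebPair m (base m y * y ^ 2 * (y - 2)) ((-n).toNat - 1)).1 -
      base m y * y * (y - 1) * (chebPair m (base m y * y ^ 2 * (y - 2)) (-n).toNat).2

theorem map_base (f : R →+* S) (m y : R) : f (base m y) = base (f m) (f y) := by
  simp [base]

theorem map_riley (f : R →+* S) (n : ℤ) (m y : R) : f (riley n m y) = riley n (f m) (f y) := by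
  unfold riley
  split_ifs <;> simp [map_chebPair, map_base, map_ofNat f 2]

/-- The degree of the Riley polynomial in `y`. -/
def rileyDegree (n : ℤ) : ℕ := if 0 ≤ n then 4 * n.toNat else 4 * (-n).toNat - 1

/-- The Riley polynomial as a polynomial in `y`. -/
def rileyPoly (n : ℤ) (m : R) : Polynomial R := riley n (Polynomial.C m) Polynomial.X

theorem eval_rileyPoly (n : ℤ) (m y : R) : (rileyPoly n m).eval y = riley n m y := by
  have := map_riley (Polynomial.evalRingHom y) n (Polynomial.C m) Polynomial.X
  simpa [rileyPoly] using this

theorem map_rileyPoly (f : R →+* S) (n : ℤ) (m : R) :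
    (rileyPoly n m).map f = rileyPoly n (f m) := by
  have := map_riley (Polynomial.mapRingHom f) n (Polynomial.C m) Polynomial.X
  simpa [rileyPoly] using this

open Polynomial in
theorem natDegree_kappa_le (m : R) :
    (base (Polynomial.C m) (Polynomial.X : Polynomial R) * Polynomial.X ^ 2 * (Polynomial.X - 2)).natDegree ≤ 4 := by
  unfold base; compute_degree

open Polynomial in
theorem coeff_kappa (m : R) :
    (base (Polynomial.C m) (Polynomial.X : Polynomial R) * Polynomial.X ^ 2 * (Polynomial.X - 2)).coeff 4 = m := by
  unfold base
  compute_degree!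

open Polynomial in
theorem natDegree_gap_le (m : R) :
    (base (Polynomial.C m) (Polynomial.X : Polynomial R) * Polynomial.X * (Polynomial.X - 1)).natDegree ≤ 3 := by
  unfold base; compute_degree

open Polynomial in
theorem coeff_gap (m : R) :
    (base (Polynomial.C m) (Polynomial.X : Polynomial R) * Polynomial.X * (Polynomial.X - 1)).coeff 3 = m := by
  unfold base
  compute_degree!

open Polynomial in
-- Coefficients are taken at the nominal degree, so that nothing has to be assumed about `m`; it may
-- vanish or be a zero divisor. The second component lags one step behind the first, hence the
-- shifted index in the last two clauses.
theorem chebPair_natDegree (m : R) {κ : Polynomial R} (hκ : κ.natDegree ≤ 4) (hm : κ.coeff 4 = m) (n : ℕ) :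
    (chebPair (Polynomial.C m) κ n).1.natDegree ≤ 4 * n ∧ (chebPair (Polynomial.C m) κ n).2.natDegree ≤ 4 * (n - 1) ∧
    (chebPair (Polynomial.C m) κ n).1.coeff (4 * n) = m ^ n ∧
    (chebPair (Polynomial.C m) κ (n + 1)).2.natDegree ≤ 4 * n ∧
    (chebPair (Polynomial.C m) κ (n + 1)).2.coeff (4 * n) = m ^ n := by
  induction n with
  | zero => simp [chebPair]
  | succ n ih =>
    obtain ⟨h1, h2, h3, h4, h5⟩ := ih
    have e : (chebPair (Polynomial.C m) κ (n + 1)).1 =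
      Polynomial.C m * (chebPair (Polynomial.C m) κ n).1 + κ * (chebPair (Polynomial.C m) κ (n + 1)).2 := rfl
    have e' : (chebPair (Polynomial.C m) κ (n + 1 + 1)).2 =
      Polynomial.C m * (chebPair (Polynomial.C m) κ (n + 1)).2 + (chebPair (Polynomial.C m) κ (n + 1)).1 := rfl
    have d1 : (chebPair (Polynomial.C m) κ (n + 1)).1.natDegree ≤ 4 * (n + 1) := by
      rw [e]
      refine natDegree_add_le_of_degree_le ?_ ?_
      · exact (natDegree_C_mul_le _ _).trans (by omega)
      · exact (natDegree_mul_le_of_le hκ h4).trans (by omega)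
    have c1 : (chebPair (Polynomial.C m) κ (n + 1)).1.coeff (4 * (n + 1)) = m ^ (n + 1) := by
      rw [e, Polynomial.coeff_add, Polynomial.coeff_C_mul, coeff_eq_zero_of_natDegree_lt (p := (chebPair (Polynomial.C m) κ n).1)
        (by omega), show 4 * (n + 1) = 4 + 4 * n by ring, coeff_mul_add_eq_of_natDegree_le hκ h4, hm, h5]
      ring
    refine ⟨d1, by simpa using h4, c1, ?_, ?_⟩
    · rw [e']
      refine natDegree_add_le_of_degree_le ?_ d1
      exact (natDegree_C_mul_le _ _).trans (by omega)
    · rw [e', Polynomial.coeff_add, Polynomial.coeff_C_mul, coeff_eq_zero_of_natDegree_lt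
        (p := (chebPair (Polynomial.C m) κ (n + 1)).2) (by omega), c1]
      ring

open Polynomial in
theorem natDegree_rileyPoly_le (n : ℤ) (m : R) : (rileyPoly n m).natDegree ≤ rileyDegree n := by
  have H := chebPair_natDegree m (natDegree_kappa_le m) (coeff_kappa m)
  unfold rileyPoly riley rileyDegree
  split_ifs with hn
  · refine natDegree_add_le_of_degree_le (H _).1 ?_
    rcases Nat.eq_zero_or_pos n.toNat with h0 | h0
    · simp [h0, chebPair]
    · exact (natDegree_mul_le_of_le (natDegree_gap_le m) (H _).2.1).trans (by omega)
  · refine (Polynomial.natDegree_sub_le _ _).trans (max_le ?_ ?_)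
    · exact (natDegree_C_mul_le _ _).trans ((H _).1.trans (by omega))
    · exact (natDegree_mul_le_of_le (natDegree_gap_le m) (H _).2.1).trans (by omega)

open Polynomial in
theorem coeff_rileyPoly (n : ℤ) (m : R) :
    (rileyPoly n m).coeff (rileyDegree n) = m ^ n.natAbs ∨
      (rileyPoly n m).coeff (rileyDegree n) = -m ^ n.natAbs := by
  have H := chebPair_natDegree m (natDegree_kappa_le m) (coeff_kappa m)
  unfold rileyPoly riley rileyDegree
  split_ifs with hn
  · left
    rcases Nat.eq_zero_or_pos n.toNat with h0 | h0
    · have : n = 0 := by omega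
      simp [this, chebPair]
    · rw [Polynomial.coeff_add, (H _).2.2.1, coeff_eq_zero_of_natDegree_lt
        ((natDegree_mul_le_of_le (natDegree_gap_le m) (H _).2.1).trans_lt (by omega)), add_zero,
        show n.toNat = n.natAbs by omega]
  · right
    obtain ⟨k, hk⟩ : ∃ k, (-n).toNat = k + 1 := ⟨(-n).toNat - 1, by omega⟩
    rw [hk, Polynomial.coeff_sub, Polynomial.coeff_C_mul, coeff_eq_zero_of_natDegree_lt
      (p := (chebPair _ _ _).1) ((H _).1.trans_lt (by omega)),
      show 4 * (k + 1) - 1 = 3 + 4 * k by omega,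
      coeff_mul_add_eq_of_natDegree_le (natDegree_gap_le m) (H k).2.2.2.1, coeff_gap, (H k).2.2.2.2,
      show n.natAbs = k + 1 by omega]
    ring

end Ring

/-! ### Chebyshev polynomials and the closed formula -/

section Field

variable {K : Type*} [Field K]

theorem chebPair_eq_S (m t : K) (n : ℕ) :
    (chebPair m (m * t) n).1 = m ^ n * ((Polynomial.Chebyshev.S K n).eval (2 + t) -
      (Polynomial.Chebyshev.S K (n - 1)).eval (2 + t)) ∧
    m * (chebPair m (m * t) n).2 = m ^ n * (Polynomial.Chebyshev.S K (n - 1)).eval (2 + t) := by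
  induction n with
  | zero => simp [chebPair]
  | succ n ih =>
    obtain ⟨h1, h2⟩ := ih
    have e := congrArg (Polynomial.eval (2 + t)) (Polynomial.Chebyshev.S_add_one K n)
    simp only [Polynomial.eval_sub, Polynomial.eval_mul, Polynomial.eval_X] at e
    simp only [chebPair, Nat.cast_add, Nat.cast_one, add_sub_cancel_right, e]
    refine ⟨?_, ?_⟩
    · linear_combination (m + m * t) * h1 + m * t * h2
    · linear_combination m * h1 + m * h2

/-- The Riley polynomial in terms of Chebyshev polynomials. -/
theorem riley_eq (n : ℤ) {m : K} (y : K) {e τ : K} (he : base m y = m * e)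
    (hτ : τ = 2 + e * y ^ 2 * (y - 2)) :
    riley n m y = m ^ n.natAbs * ((Polynomial.Chebyshev.S K (n - 1)).eval τ
      * (τ - 1 + e * y * (y - 1)) - (Polynomial.Chebyshev.S K (n - 2)).eval τ) := by
  subst hτ
  have hk : base m y * y ^ 2 * (y - 2) = m * (e * y ^ 2 * (y - 2)) := by rw [he]; ring
  have H := chebPair_eq_S m (e * y ^ 2 * (y - 2))
  unfold riley
  rw [hk]
  set t := e * y ^ 2 * (y - 2)
  split_ifs with hn
  · lift n to ℕ using hn
    have E := congrArg (Polynomial.eval (2 + t)) (Polynomial.Chebyshev.S_eq K n)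
    simp only [Polynomial.eval_sub, Polynomial.eval_mul, Polynomial.eval_X] at E
    simp only [Int.toNat_natCast, Int.natAbs_natCast]
    rw [(H n).1, he]
    linear_combination e * y * (y - 1) * (H n).2 + m ^ n * E
  · obtain ⟨k, rfl⟩ : ∃ k : ℕ, n = -(k + 1) := ⟨(-n).toNat - 1, by omega⟩
    have h1 : (-(-((k : ℤ) + 1))).toNat = k + 1 := by omega
    have h2 : (-((k : ℤ) + 1)).natAbs = k + 1 := by omega
    rw [h1, h2, Nat.add_sub_cancel, (H k).1, he]
    have h3 := (H (k + 1)).2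
    have s1 := Polynomial.Chebyshev.S_neg_sub_two K k
    have s2 := Polynomial.Chebyshev.S_neg_sub_two K (k + 1)
    -- The reflection `S_{-k-2} = -S_k` brings negative indices back to natural ones.
    rw [show -((k : ℤ) + 1) - 1 = -k - 2 by ring, s1, s2]
    have E := congrArg (Polynomial.eval (2 + t)) (Polynomial.Chebyshev.S_add_one K k)
    simp only [Polynomial.eval_sub, Polynomial.eval_mul, Polynomial.eval_X, Polynomial.eval_neg,
      Nat.cast_add, Nat.cast_one, add_sub_cancel_right] at E h3 ⊢
    rw [E]
    linear_combination (-e * y * (y - 1)) * h3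

/-- Pascal's rule, applied to both recursions. These are the expansions of `S_n - S_{n-1}` and
`S_{n-1}` at `2 + t` in powers of `t`; they supply the even and the odd summands of `pFormula`. -/
theorem chebPair_eq_sum (m t : K) (n : ℕ) :
    (chebPair m (m * t) n).1 = m ^ n * ∑ j ∈ Finset.range (n + 1), ((n + j).choose (2 * j) : K) * t ^ j ∧
    m * (chebPair m (m * t) n).2 =
      m ^ n * ∑ j ∈ Finset.range n, ((n + j).choose (2 * j + 1) : K) * t ^ j := by
  induction n with
  | zero => simp [chebPair]
  | succ n ih =>
    obtain ⟨h1, h2⟩ := ih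
    have e1 : ∑ j ∈ Finset.range (n + 1), ((n + 1 + j).choose (2 * j + 1) : K) * t ^ j =
        ∑ j ∈ Finset.range n, ((n + j).choose (2 * j + 1) : K) * t ^ j +
        ∑ j ∈ Finset.range (n + 1), ((n + j).choose (2 * j) : K) * t ^ j := by
      have : ∑ j ∈ Finset.range n, ((n + j).choose (2 * j + 1) : K) * t ^ j =
          ∑ j ∈ Finset.range (n + 1), ((n + j).choose (2 * j + 1) : K) * t ^ j := by
        rw [Finset.sum_range_succ, Nat.choose_eq_zero_of_lt (by omega : n + n < 2 * n + 1)]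
        simp
      rw [this, ← Finset.sum_add_distrib]
      refine Finset.sum_congr rfl fun j _ => ?_
      rw [show n + 1 + j = n + j + 1 by ring, Nat.choose_succ_succ]
      push_cast; ring
    have e2 : ∑ j ∈ Finset.range (n + 1 + 1), ((n + 1 + j).choose (2 * j) : K) * t ^ j =
        ∑ j ∈ Finset.range (n + 1), ((n + j).choose (2 * j) : K) * t ^ j +
        t * ∑ j ∈ Finset.range (n + 1), ((n + 1 + j).choose (2 * j + 1) : K) * t ^ j := by
      have : ∑ j ∈ Finset.range (n + 1), ((n + j).choose (2 * j) : K) * t ^ j =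
          ∑ j ∈ Finset.range (n + 1 + 1), ((n + j).choose (2 * j) : K) * t ^ j := by
        rw [Finset.sum_range_succ _ (n + 1),
          Nat.choose_eq_zero_of_lt (by omega : n + (n + 1) < 2 * (n + 1))]
        simp
      rw [this, Finset.sum_range_succ' _ (n + 1), Finset.sum_range_succ' _ (n + 1), Finset.mul_sum]
      simp only [mul_zero, Nat.choose_zero_right]
      rw [add_right_comm, ← Finset.sum_add_distrib]
      congr 1
      refine Finset.sum_congr rfl fun j _ => ?_
      rw [show n + 1 + (j + 1) = n + 1 + j + 1 by ring, show 2 * (j + 1) = 2 * j + 1 + 1 by ring,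
        Nat.choose_succ_succ, show n + (j + 1) = n + 1 + j by ring]
      push_cast; ring
    simp only [chebPair]
    rw [e2, e1]
    refine ⟨?_, ?_⟩
    · linear_combination (m + m * t) * h1 + m * t * h2
    · linear_combination m * h1 + m * h2

theorem sum_range_even_odd (f : ℕ → K) (n : ℕ) : ∑ i ∈ Finset.range (2 * n + 1), f i =
    ∑ j ∈ Finset.range (n + 1), f (2 * j) + ∑ j ∈ Finset.range n, f (2 * j + 1) := by
  induction n with
  | zero => simp
  | succ n ih =>
    rw [show 2 * (n + 1) + 1 = 2 * n + 1 + 1 + 1 by ring, Finset.sum_range_succ,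
      Finset.sum_range_succ, ih, Finset.sum_range_succ (fun j => f (2 * j + 1)) n,
      Finset.sum_range_succ (fun j => f (2 * j)) (n + 1), show 2 * (n + 1) = 2 * n + 1 + 1 by ring]
    ring

/-- The general summand of `pFormula` in terms of `y`, for an even index. -/
theorem summand_even {m Q y w b : K} (h2 : (2 : K) ≠ 0) (hm : m ≠ 0) (hQ : Q ≠ 0) (hw : w ≠ 0)
    (N j : ℕ) (e : K) {T : K} (hT : T = Q ^ (-2 * ((((2 * j : ℕ) : ℤ) + 1) / 2) - (2 * j : ℕ) ) * e) :
    2 ^ (-2 * ((((2 * j : ℕ) : ℤ) + 1) / 2) - (2 * j : ℕ))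
      * m ^ (-(((2 * j : ℕ) : ℤ) / 2) - 2 * ((((2 * j : ℕ) : ℤ) + 1) / 2) + (2 * j : ℕ) + N)
      * T * (2 * Q * b) ^ ((((2 * j : ℕ) : ℤ) + 1) / 2) * (2 * Q * y) ^ (2 * j)
      * (2 * Q * w) ^ ((((2 * j : ℕ) : ℤ) - 1) / 2) * (2 * Q * w) =
    e * (m ^ N * (b / m * y ^ 2 * w) ^ j) := by
  subst hT
  have a1 : (((2 * j : ℕ) : ℤ) + 1) / 2 = j := by omega
  have a2 : ((2 * j : ℕ) : ℤ) / 2 = j := by omega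
  have a3 : (((2 * j : ℕ) : ℤ) - 1) / 2 = j - 1 := by omega
  -- For `j = 0` the exponent `⌊(i - 1) / 2⌋` is `-1`. The last factor `2 * Q * w` makes up for it,
  -- and this is where `w ≠ 0` matters.
  have hz : 2 * Q * w ≠ 0 := by positivity
  rw [a1, a2, a3, mul_assoc _ (_ ^ ((j : ℤ) - 1)), ← zpow_add_one₀ hz, sub_add_cancel]
  rw [show -2 * (j : ℤ) - ((2 * j : ℕ) : ℤ) = -((4 * j : ℕ) : ℤ) by push_cast; ring,
    show -(j : ℤ) - 2 * j + ((2 * j : ℕ) : ℤ) + N = -(j : ℤ) + N by push_cast; ring,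
    zpow_add₀ hm]
  simp only [zpow_neg, zpow_natCast, mul_pow, div_pow]
  field_simp
  ring

/-- As in the even case, all powers of `2 * Q` cancel. The factor `T` is kept abstract so that one
computation serves both the integral powers of `Q` for `n ≥ 0` and the half-integral ones for `n <
0`. -/
theorem summand_odd {m Q y w b v : K} (h2 : (2 : K) ≠ 0) (hm : m ≠ 0) (hQ : Q ≠ 0)
    (N j : ℕ) (e : K) {T : K}
    (hT : T = Q ^ (-2 * ((((2 * j + 1 : ℕ) : ℤ) + 1) / 2) - (2 * j + 1 : ℕ) ) * e) :
    2 ^ (-2 * ((((2 * j + 1 : ℕ) : ℤ) + 1) / 2) - (2 * j + 1 : ℕ))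
      * m ^ (-(((2 * j + 1 : ℕ) : ℤ) / 2) - 2 * ((((2 * j + 1 : ℕ) : ℤ) + 1) / 2)
        + (2 * j + 1 : ℕ) + N)
      * T * (2 * Q * b) ^ ((((2 * j + 1 : ℕ) : ℤ) + 1) / 2) * (2 * Q * y) ^ (2 * j + 1)
      * (2 * Q * w) ^ ((((2 * j + 1 : ℕ) : ℤ) - 1) / 2) * (2 * Q * v) =
    e * (m ^ N * (b / m * y * v * (b / m * y ^ 2 * w) ^ j)) := by
  subst hT
  have a1 : (((2 * j + 1 : ℕ) : ℤ) + 1) / 2 = (j + 1 : ℕ) := by omega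
  have a2 : ((2 * j + 1 : ℕ) : ℤ) / 2 = j := by omega
  have a3 : (((2 * j + 1 : ℕ) : ℤ) - 1) / 2 = j := by omega
  rw [a1, a2, a3]
  rw [show -2 * ((j + 1 : ℕ) : ℤ) - ((2 * j + 1 : ℕ) : ℤ) = -((4 * j + 3 : ℕ) : ℤ) by push_cast; ring,
    show -(j : ℤ) - 2 * ((j + 1 : ℕ) : ℤ) + ((2 * j + 1 : ℕ) : ℤ) + N = -((j + 1 : ℕ) : ℤ) + N by
      push_cast; ring, zpow_add₀ hm]
  simp only [zpow_neg, zpow_natCast, mul_pow, div_pow]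
  field_simp
  ring

/-- The closed formula is the Riley polynomial, up to a power of `r`. -/
theorem pFormula_eq (n : ℤ) {L M r y z : K} (h2 : (2 : K) ≠ 0) (hM : M ≠ 0) (hr0 : r ≠ 0)
    (hr : r ^ 2 = L * M ^ 2 + 1) (hy : y - 2 ≠ 0)
    (hz : z = 2 * (L * M ^ 2 + 1) * y - (L * M ^ 2 + L + M ^ 2 + 1)) :
    pFormula n L M r z = r ^ rileyDegree n * riley n (M ^ 2) y := by
  have hm : M ^ 2 ≠ 0 := pow_ne_zero _ hM
  have hQ : L * M ^ 2 + 1 ≠ 0 := hr ▸ pow_ne_zero _ hr0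
  have hk : base (M ^ 2) y * y ^ 2 * (y - 2) = M ^ 2 * (base (M ^ 2) y / M ^ 2 * y ^ 2 * (y - 2)) := by
    field_simp
  -- In terms of `y` the bases of the powers in the formula are `2 * (L * M ^ 2 + 1)` times `base`,
  -- `y` and `y - 2`.
  have f1 : -2 * L * M ^ 6 + L * M ^ 4 - L * M ^ 2 - M ^ 4 + M ^ 2 * z + M ^ 2 - 2 =
      2 * (L * M ^ 2 + 1) * base (M ^ 2) y := by rw [hz, base]; ring
  have f2 : L * M ^ 2 + L + M ^ 2 + z + 1 = 2 * (L * M ^ 2 + 1) * y := by rw [hz]; ring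
  have f3 : -3 * L * M ^ 2 + L + M ^ 2 + z - 3 = 2 * (L * M ^ 2 + 1) * (y - 2) := by rw [hz]; ring
  have H := chebPair_eq_sum (M ^ 2) (base (M ^ 2) y / M ^ 2 * y ^ 2 * (y - 2))
  unfold pFormula riley rileyDegree
  simp only [f1, f2, f3, hk]
  generalize hb : base (M ^ 2) y = b
  rw [hb] at H
  split_ifs with hn
  · lift n to ℕ using hn
    simp only [Int.toNat_natCast]
    rw [show (2 * (n : ℤ)).toNat = 2 * n by omega, sum_range_even_odd, (H n).1]
    have h2' : b * y * (y - 1) * (chebPair (M ^ 2) (M ^ 2 * (b / M ^ 2 * y ^ 2 * (y - 2))) n).2 =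
        b / M ^ 2 * y * (y - 1) * (M ^ 2 *
          (chebPair (M ^ 2) (M ^ 2 * (b / M ^ 2 * y ^ 2 * (y - 2))) n).2) := by field_simp
    rw [h2', (H n).2, mul_add (r ^ (4 * n))]
    simp only [Finset.mul_sum]
    have hT : ∀ e : ℤ, (L * M ^ 2 + 1) ^ (e + 2 * (n : ℤ)) = (L * M ^ 2 + 1) ^ e * r ^ (4 * n) := by
      intro e
      rw [zpow_add₀ hQ, zpow_mul, zpow_natCast, ← hr, zpow_ofNat, ← pow_mul, ← pow_mul,
        show 2 * (2 * n) = 4 * n by ring]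
    refine congrArg₂ (· + ·) (Finset.sum_congr rfl fun j _ => ?_)
      (Finset.sum_congr rfl fun j _ => ?_)
    · have := summand_even (y := y) (b := b) h2 hm hQ hy n j (r ^ (4 * n)) (hT _)
      rw [show ((2 * j : ℕ) : ℤ) / 2 + n = ((n + j : ℕ) : ℤ) by omega, Ring.choose_natCast,
        Odd.neg_one_pow ⟨j, rfl⟩, show -1 * (L * M ^ 2 + 1) - 2 * L * M ^ 2 + L + M ^ 2 + z - 2 =
          2 * (L * M ^ 2 + 1) * (y - 2) by rw [hz]; ring]
      rw [Int.cast_natCast]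
      linear_combination (((n + j).choose (2 * j) : ℕ) : K) * this
    · have := summand_odd (y := y) (w := y - 2) (v := y - 1) (b := b) h2 hm hQ n j (r ^ (4 * n)) (hT _)
      rw [show ((2 * j + 1 : ℕ) : ℤ) / 2 + n = ((n + j : ℕ) : ℤ) by omega, Ring.choose_natCast,
        Even.neg_one_pow ⟨j + 1, by ring⟩, show 1 * (L * M ^ 2 + 1) - 2 * L * M ^ 2 + L + M ^ 2 + z - 2 =
          2 * (L * M ^ 2 + 1) * (y - 1) by rw [hz]; ring]
      rw [Int.cast_natCast]
      linear_combination (((n + j).choose (2 * j + 1) : ℕ) : K) * this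
  · obtain ⟨k, rfl⟩ : ∃ k : ℕ, n = -(k + 1) := ⟨(-n).toNat - 1, by omega⟩
    have h1 : (-(-((k : ℤ) + 1))).toNat = k + 1 := by omega
    rw [h1, show (-2 * -((k : ℤ) + 1)).toNat = 2 * (k + 1) by omega, sum_range_even_odd,
      Nat.add_sub_cancel, (H k).1]
    have h2' : b * y * (y - 1) * (chebPair (M ^ 2) (M ^ 2 * (b / M ^ 2 * y ^ 2 * (y - 2))) (k + 1)).2 =
        b / M ^ 2 * y * (y - 1) * (M ^ 2 *
          (chebPair (M ^ 2) (M ^ 2 * (b / M ^ 2 * y ^ 2 * (y - 2))) (k + 1)).2) := by field_simp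
    rw [h2', (H (k + 1)).2, sub_eq_add_neg (M ^ 2 * _), mul_add (r ^ (4 * (k + 1) - 1)),
      mul_neg (r ^ (4 * (k + 1) - 1)),
      Finset.sum_range_succ _ (k + 1)]
    -- For `n < 0` the top summand has the binomial coefficient `(2k+1 choose 2k+2) = 0`, which
    -- leaves one even summand fewer.
    have htop : (Ring.choose ((((2 * (k + 1) : ℕ) : ℤ) - 1) / 2 - -((k : ℤ) + 1)) (2 * (k + 1))) = 0 := by
      rw [show (((2 * (k + 1) : ℕ) : ℤ) - 1) / 2 - -((k : ℤ) + 1) = ((2 * k + 1 : ℕ) : ℤ) by omega,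
        Ring.choose_natCast, Nat.choose_eq_zero_of_lt (by omega)]
      rfl
    rw [htop]
    simp only [Int.cast_zero, zero_mul, add_zero, Finset.mul_sum, ← Finset.sum_neg_distrib]
    have hT : ∀ e : ℤ, r ^ (-1 + 2 * (e - 2 * -((k : ℤ) + 1))) =
        (L * M ^ 2 + 1) ^ e * r ^ (4 * (k + 1) - 1) := by
      intro e
      rw [show -1 + 2 * (e - 2 * -((k : ℤ) + 1)) = 2 * e + ((4 * (k + 1) - 1 : ℕ) : ℤ) by omega,
        zpow_add₀ hr0, zpow_mul, zpow_natCast, ← hr, zpow_ofNat]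
    refine congrArg₂ (· + ·) (Finset.sum_congr rfl fun j _ => ?_)
      (Finset.sum_congr rfl fun j _ => ?_)
    · have := summand_even (y := y) (b := b) h2 hm hQ hy (k + 1) j (r ^ (4 * (k + 1) - 1)) (hT _)
      rw [show (((2 * j : ℕ) : ℤ) - 1) / 2 - -((k : ℤ) + 1) = ((k + j : ℕ) : ℤ) by omega,
        Ring.choose_natCast, Even.neg_one_pow ⟨j, by ring⟩,
        show 1 * (-2 * L * M ^ 2 + L + M ^ 2 + z - 2) - L * M ^ 2 - 1 =
          2 * (L * M ^ 2 + 1) * (y - 2) by rw [hz]; ring]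
      rw [Int.cast_natCast, sub_neg_eq_add]
      rw [Nat.cast_add k 1, Nat.cast_one] at this
      linear_combination (((k + j).choose (2 * j) : ℕ) : K) * this
    · have := summand_odd (y := y) (w := y - 2) (v := y - 1) (b := b) h2 hm hQ (k + 1) j
        (r ^ (4 * (k + 1) - 1)) (hT _)
      rw [show (((2 * j + 1 : ℕ) : ℤ) - 1) / 2 - -((k : ℤ) + 1) = ((k + 1 + j : ℕ) : ℤ) by omega,
        Ring.choose_natCast, Odd.neg_one_pow ⟨j, rfl⟩,
        show -1 * (-2 * L * M ^ 2 + L + M ^ 2 + z - 2) - L * M ^ 2 - 1 =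
          -(2 * (L * M ^ 2 + 1) * (y - 1)) by rw [hz]; ring]
      rw [Int.cast_natCast, sub_neg_eq_add]
      rw [Nat.cast_add k 1, Nat.cast_one] at this
      linear_combination -(((k + 1 + j).choose (2 * j + 1) : ℕ) : K) * this

end Field

/-! ### Elimination of `y`, and special values -/

section Ring

variable {R S : Type*} [CommRing R] [CommRing S]

/-- The quadratic equation for the trace `y` in terms of the eigenvalues `L` and `M`, `m = M ^ 2`. -/
def quadPoly (L m : R) : Polynomial R :=
  Polynomial.C (L * m + 1) * Polynomial.X ^ 2 - Polynomial.C ((L + 1) * (m + 1)) * Polynomial.X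
    - Polynomial.C ((L - 1) * (m - 1))

theorem natDegree_quadPoly_le (L m : R) : (quadPoly L m).natDegree ≤ 2 := by
  unfold quadPoly; compute_degree

theorem eval_quadPoly (L m y : R) : (quadPoly L m).eval y =
    (L * m + 1) * y ^ 2 - (L + 1) * (m + 1) * y - (L - 1) * (m - 1) := by
  simp [quadPoly]

/-- The elimination of `y` from the Riley polynomial and the quadratic equation. -/
def eliminant (n : ℤ) (L m : R) : R :=
  -- The degrees are prescribed rather than actual, so that the resultant commutes with every ring
  -- homomorphism, even when a leading coefficient vanishes.
  (rileyPoly n m).resultant (quadPoly L m) (rileyDegree n) 2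

theorem map_eliminant (f : R →+* S) (n : ℤ) (L m : R) :
    f (eliminant n L m) = eliminant n (f L) (f m) := by
  have : (quadPoly L m).map f = quadPoly (f L) (f m) := by simp [quadPoly]
  rw [eliminant, eliminant, ← Polynomial.resultant_map_map, map_rileyPoly, this]

theorem eliminant_eq_mul [Nontrivial R] (n : ℤ) {L m y₁ y₂ : R}
    (hadd : (L * m + 1) * (y₁ + y₂) = (L + 1) * (m + 1))
    (hmul : (L * m + 1) * (y₁ * y₂) = -((L - 1) * (m - 1))) :
    eliminant n L m = (L * m + 1) ^ rileyDegree n * (riley n m y₁ * riley n m y₂) := by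
  have hq : quadPoly L m = Polynomial.C (L * m + 1) *
      ((Polynomial.X - Polynomial.C y₁) * (Polynomial.X - Polynomial.C y₂)) := by
    unfold quadPoly
    have h1 := congrArg Polynomial.C hadd
    have h2 := congrArg Polynomial.C hmul
    simp only [map_mul, map_add, map_neg] at h1 h2 ⊢
    linear_combination Polynomial.X * h1 - h2
  have hd := natDegree_rileyPoly_le n m
  have hm := Polynomial.resultant_mul_right (rileyPoly n m) (Polynomial.X - Polynomial.C y₁)
    (Polynomial.X - Polynomial.C y₂) _ hd
  rw [Polynomial.natDegree_X_sub_C, Polynomial.natDegree_X_sub_C,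
    Polynomial.resultant_X_sub_C_right _ _ _ hd, Polynomial.resultant_X_sub_C_right _ _ _ hd,
    eval_rileyPoly, eval_rileyPoly] at hm
  rw [eliminant, hq, Polynomial.resultant_C_mul_right, hm]
  have : (-1 : R) ^ rileyDegree n * (-1) ^ rileyDegree n = 1 := by
    rw [← mul_pow]; simp
  linear_combination (L * m + 1) ^ rileyDegree n * riley n m y₁ * riley n m y₂ * this

/-- The resultant lies in the ideal generated by the two polynomials, so it vanishes where they have
a common root. No division by `L * m + 1` is involved. -/
theorem eliminant_eq_zero (n : ℤ) {L m y : R}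
    (hq : (L * m + 1) * y ^ 2 - (L + 1) * (m + 1) * y - (L - 1) * (m - 1) = 0)
    (hr : riley n m y = 0) : eliminant n L m = 0 := by
  obtain ⟨p, q, -, -, h⟩ := Polynomial.exists_mul_add_mul_eq_C_resultant (rileyPoly n m)
    (quadPoly L m) (natDegree_rileyPoly_le n m) (natDegree_quadPoly_le L m) (Or.inr two_ne_zero)
  have := congrArg (Polynomial.eval y) h
  rw [Polynomial.eval_C, Polynomial.eval_add, Polynomial.eval_mul, Polynomial.eval_mul,
    eval_rileyPoly, eval_quadPoly, hq, hr] at this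
  rw [eliminant, ← this]
  ring

/-- The eliminant where the quadratic equation degenerates to a linear one, with the root `1`. -/
theorem eliminant_degenerate (n : ℤ) {L m : R} (h : L * m + 1 = 0) :
    eliminant n L m = (-((L + 1) * (m + 1))) ^ rileyDegree n *
      ((rileyPoly n m).coeff (rileyDegree n) * ((-1) ^ rileyDegree n * riley n m 1)) := by
  have hq : quadPoly L m = Polynomial.C (-((L + 1) * (m + 1))) *
      (Polynomial.X - Polynomial.C 1) := by
    unfold quadPoly
    rw [h]
    have := congrArg Polynomial.C h
    simp only [map_mul, map_add, map_neg, map_sub, map_one, map_zero] at this ⊢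
    linear_combination -2 * this
  have hd := natDegree_rileyPoly_le n m
  rw [eliminant, hq, Polynomial.resultant_C_mul_right]
  congr 1
  -- The nominal degree is `2` and the actual one at most `1`; each missing degree contributes the
  -- leading coefficient of the Riley polynomial, up to sign.
  have := Polynomial.resultant_add_right_deg (rileyPoly n m) (Polynomial.X - Polynomial.C 1)
    (rileyDegree n) 1 1 (Polynomial.natDegree_X_sub_C_le _)
  rw [show (2 : ℕ) = 1 + 1 from rfl, this, Polynomial.resultant_X_sub_C_right _ _ _ hd,
    eval_rileyPoly, pow_one]

theorem chebPair_zero_right (m : R) (n : ℕ) : (chebPair m 0 n).1 = m ^ n := by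
  induction n with
  | zero => simp [chebPair]
  | succ n ih => simp [chebPair, ih, pow_succ']

/-- This covers `y = 0` as well as `base m y = 0`; the latter is the trace condition satisfied by
one family of reducible pairs. -/
theorem riley_of_gap_eq_zero (n : ℤ) {m y : R} (hk : base m y * y ^ 2 * (y - 2) = 0)
    (hg : base m y * y * (y - 1) = 0) : riley n m y = m ^ n.natAbs := by
  unfold riley
  rw [hk, hg]
  split_ifs with hn
  · rw [chebPair_zero_right, show n.toNat = n.natAbs by omega]; ring
  · rw [chebPair_zero_right, show n.natAbs = (-n).toNat - 1 + 1 by omega]; ring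

theorem riley_zero_right (n : ℤ) (m : R) : riley n m 0 = m ^ n.natAbs :=
  riley_of_gap_eq_zero n (by ring) (by ring)

theorem riley_one_two (n : ℤ) : riley n (1 : R) 2 = 1 := by
  rw [riley_of_gap_eq_zero n (by ring) (by unfold base; ring), one_pow]

/-- Here `tr R = -2`, where Chebyshev polynomials take values linear in the index up to sign; the
linear terms cancel. -/
theorem riley_neg_one (n : ℤ) {y : R} (hy : y ^ 2 = 2) : riley n (-1) y = 1 := by
  have hk : base (-1) y * y ^ 2 * (y - 2) = 4 := by
    unfold base; linear_combination (-y ^ 2 + 2) * hy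
  have hg : base (-1) y * y * (y - 1) = -2 := by
    unfold base; linear_combination (-y - 1) * hy
  have H : ∀ k : ℕ, (chebPair (-1 : R) 4 k).1 = 2 * k + 1 ∧ (chebPair (-1 : R) 4 k).2 = k := by
    intro k
    induction k with
    | zero => simp [chebPair]
    | succ k ih => simp only [chebPair, ih.1, ih.2]; push_cast; constructor <;> ring
  unfold riley
  rw [hk, hg]
  split_ifs with hn
  · rw [(H _).1, (H _).2]; ring
  · obtain ⟨k, hk⟩ : ∃ k, (-n).toNat = k + 1 := ⟨(-n).toNat - 1, by omega⟩
    rw [(H _).1, (H _).2, hk, Nat.add_sub_cancel]; push_cast; ring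

/-- At `m = 0` the Chebyshev recursions degenerate to powers of `κ`, and the Riley polynomial
factors explicitly. -/
theorem riley_zero_left_ne_zero {K : Type*} [Field K] (n : ℤ) {y : K} (h0 : y ≠ 0) (h1 : y - 1 ≠ 0)
    (h2 : y - 2 ≠ 0) (h3 : y ^ 2 - y - 1 ≠ 0) : riley n 0 y ≠ 0 := by
  have H : ∀ (κ : K) (k : ℕ), (chebPair 0 κ k).1 = κ ^ k ∧ (chebPair 0 κ (k + 1)).2 = κ ^ k := by
    intro κ k
    induction k with
    | zero => simp [chebPair]
    | succ k ih =>
      have : (chebPair 0 κ (k + 1)).1 = κ ^ (k + 1) := by simp [chebPair, ih.1, pow_succ']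
      exact ⟨this, by simp [chebPair, ← this]⟩
  unfold riley
  split_ifs with hn
  · rcases Nat.eq_zero_or_pos n.toNat with hz | hz
    · simp [hz, chebPair]
    · obtain ⟨k, hk⟩ : ∃ k, n.toNat = k + 1 := ⟨n.toNat - 1, by omega⟩
      rw [hk, (H _ _).1, (H _ _).2]
      have : (base 0 y * y ^ 2 * (y - 2)) ^ (k + 1) +
          base 0 y * y * (y - 1) * (base 0 y * y ^ 2 * (y - 2)) ^ k =
          (-1 * y ^ 2 * (y - 2)) ^ k * (-1 * y * (y ^ 2 - y - 1)) := by
        simp only [base]; ring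
      rw [this]
      simp [h0, h2, h3]
  · obtain ⟨k, hk⟩ : ∃ k, (-n).toNat = k + 1 := ⟨(-n).toNat - 1, by omega⟩
    rw [hk, (H _ _).2]
    simp [base, h0, h1, h2]

/-- At `L = 0`, `m = 1` the quadratic is `y ^ 2 - 2 * y`. The value `1` yields coprime coefficients
and excludes the lines `L = 0` and `M = ±1`. -/
theorem eliminant_zero_one (n : ℤ) : eliminant n (0 : ℤ) 1 = 1 := by
  rw [eliminant_eq_mul n (y₁ := 0) (y₂ := 2) (by norm_num) (by norm_num), riley_zero_right,
    riley_one_two]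
  simp

theorem eliminant_one_one (n : ℤ) : eliminant n (1 : ℤ) 1 ≠ 0 := by
  rw [eliminant_eq_mul n (y₁ := 0) (y₂ := 2) (by norm_num) (by norm_num), riley_zero_right,
    riley_one_two]
  simp

theorem eliminant_zero_neg_one (n : ℤ) : eliminant n (0 : ℂ) (-1) ≠ 0 := by
  obtain ⟨w, hw⟩ := IsAlgClosed.exists_pow_nat_eq (2 : ℂ) (n := 2) (by norm_num)
  rw [eliminant_eq_mul n (y₁ := w) (y₂ := -w) (by ring) (by linear_combination -hw),
    riley_neg_one n hw, riley_neg_one n (by linear_combination hw)]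
  simp

theorem eliminant_right_zero (n : ℤ) : eliminant n (5 / 2 : ℂ) 0 ≠ 0 := by
  -- The value `L = 5 / 2` makes the roots rational and keeps them away from the zeros `0`, `1`, `2`
  -- and those of `y ^ 2 - y - 1`.
  rw [eliminant_eq_mul n (y₁ := 3) (y₂ := 1 / 2) (by norm_num) (by norm_num)]
  refine mul_ne_zero (by simp) (mul_ne_zero ?_ ?_) <;>
    apply riley_zero_left_ne_zero <;> norm_num

theorem exists_eliminant_degenerate (n : ℤ) :
    ∃ L M : ℂ, L * M ^ 2 + 1 = 0 ∧ eliminant n L (M ^ 2) ≠ 0 := by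
  obtain ⟨w, hw⟩ := IsAlgClosed.exists_pow_nat_eq (-3 : ℂ) (n := 2) (by norm_num)
  obtain ⟨M, hM⟩ := IsAlgClosed.exists_pow_nat_eq ((1 + w) / 2) (n := 2) (by norm_num)
  set m := M ^ 2 with hm
  -- A primitive sixth root of unity `m` makes `base m 1 = 0`, so the Riley polynomial is a power of
  -- `m` at the only root `1` of the degenerate quadratic.
  have h : m ^ 2 - m + 1 = 0 := by rw [hM]; linear_combination hw / 4
  have h0 : m ≠ 0 := by rintro h'; rw [h'] at h; norm_num at h
  have hb : base m 1 = 0 := by unfold base; linear_combination -h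
  have hL : m - 1 ≠ 0 := by
    intro h'; have : m = 1 := by linear_combination h'
    rw [this] at h; norm_num at h
  have hR : m + 1 ≠ 0 := by
    intro h'; have : m = -1 := by linear_combination h'
    rw [this] at h; norm_num at h
  have hQ : -1 / m * m + 1 = 0 := by field_simp; ring
  refine ⟨-1 / m, M, hQ, ?_⟩
  rw [← hm, eliminant_degenerate n hQ, riley_of_gap_eq_zero n (by rw [hb]; ring) (by rw [hb]; ring)]
  have hL' : -1 / m + 1 ≠ 0 := by
    rw [show -1 / m + 1 = (m - 1) / m by field_simp; ring]
    exact div_ne_zero hL h0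
  have hc : (rileyPoly n m).coeff (rileyDegree n) ≠ 0 := by
    rcases coeff_rileyPoly n m with e | e <;> rw [e] <;> simp [h0]
  simp [hL', hR, hc, h0]

end Ring

/-- The polynomial `p_{2n}(u) p_{2n}(-u)`. -/
def curvePoly (n : ℤ) : PolyLM := eliminant n (X 0) (X 1 ^ 2)

theorem aeval_curvePoly {K : Type*} [CommRing K] (n : ℤ) (v : Fin 2 → K) :
    aeval v (curvePoly n) = eliminant n (v 0) (v 1 ^ 2) := by
  have := map_eliminant (aeval v : PolyLM →ₐ[ℤ] K).toRingHom n (X 0) (X 1 ^ 2)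
  simpa [curvePoly] using this

theorem algebraMap_curvePoly (n : ℤ) :
    algebraMap PolyLM AlgFun (curvePoly n) = eliminant n Lfun (Mfun ^ 2) := by
  rw [curvePoly, map_eliminant, map_pow]; rfl

/-- `PolyLM` embeds into `AlgFun`, so one nonzero integer value is a certificate. -/
theorem algebraMap_algFun_ne_zero {p : PolyLM} (v : Fin 2 → ℤ) (hp : aeval v p ≠ 0) :
    algebraMap PolyLM AlgFun p ≠ 0 := by
  have hinj : Function.Injective (algebraMap PolyLM AlgFun) := by
    rw [IsScalarTower.algebraMap_eq PolyLM (FractionRing PolyLM) AlgFun, RingHom.coe_comp]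
    exact (algebraMap (FractionRing PolyLM) AlgFun).injective.comp
      (IsFractionRing.injective PolyLM (FractionRing PolyLM))
  rw [map_ne_zero_iff _ hinj]
  rintro rfl
  simp at hp

theorem pFormula_mul_pFormula (n : ℤ) {u r : AlgFun} (hu : u ^ 2 = uSquared Lfun Mfun)
    (hr : r ^ 2 = Lfun * Mfun ^ 2 + 1) :
    pFormula n Lfun Mfun r u * pFormula n Lfun Mfun r (-u) =
      algebraMap PolyLM AlgFun (curvePoly n) := by
  have h2 : (2 : AlgFun) ≠ 0 := two_ne_zero
  have hM : Mfun ≠ 0 := algebraMap_algFun_ne_zero ![1, 1] (by simp)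
  have hL1 : Lfun - 1 ≠ 0 := by
    have := algebraMap_algFun_ne_zero (p := X 0 - 1) ![2, 1] (by simp)
    simpa [Lfun] using this
  have hM1 : Mfun ^ 2 - 1 ≠ 0 := by
    have := algebraMap_algFun_ne_zero (p := X 1 ^ 2 - 1) ![2, 2] (by simp)
    simpa [Mfun] using this
  have hQ : Lfun * Mfun ^ 2 + 1 ≠ 0 := by
    have := algebraMap_algFun_ne_zero (p := X 0 * X 1 ^ 2 + 1) ![2, 2] (by simp)
    simpa [Mfun, Lfun] using this
  have hr0 : r ≠ 0 := by rintro rfl; apply hQ; rw [← hr]; ring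
  rw [algebraMap_curvePoly]
  generalize Lfun = L at *
  generalize Mfun = M at *
  unfold uSquared at hu
  obtain ⟨y₁, hy₁⟩ : ∃ y₁, u = 2 * (L * M ^ 2 + 1) * y₁ - (L * M ^ 2 + L + M ^ 2 + 1) :=
    ⟨(u + (L * M ^ 2 + L + M ^ 2 + 1)) / (2 * (L * M ^ 2 + 1)), by field_simp; ring⟩
  obtain ⟨y₂, hy₂⟩ : ∃ y₂, -u = 2 * (L * M ^ 2 + 1) * y₂ - (L * M ^ 2 + L + M ^ 2 + 1) :=
    ⟨(-u + (L * M ^ 2 + L + M ^ 2 + 1)) / (2 * (L * M ^ 2 + 1)), by field_simp; ring⟩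
  have hadd : (L * M ^ 2 + 1) * (y₁ + y₂) = (L + 1) * (M ^ 2 + 1) := by
    apply mul_left_cancel₀ h2
    linear_combination -hy₁ - hy₂
  have hmul : (L * M ^ 2 + 1) * (y₁ * y₂) = -((L - 1) * (M ^ 2 - 1)) := by
    have h4 : 4 * (L * M ^ 2 + 1) ≠ 0 := mul_ne_zero (by norm_num) hQ
    apply mul_left_cancel₀ h4
    have e1 : 2 * (L * M ^ 2 + 1) * y₁ = u + (L * M ^ 2 + L + M ^ 2 + 1) := by
      linear_combination -hy₁
    have e2 : 2 * (L * M ^ 2 + 1) * y₂ = -u + (L * M ^ 2 + L + M ^ 2 + 1) := by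
      linear_combination -hy₂
    linear_combination (2 * (L * M ^ 2 + 1) * y₂) * e1 + (u + (L * M ^ 2 + L + M ^ 2 + 1)) * e2 - hu
  -- The value of the quadratic polynomial at `2`. It is nonzero, so neither root is `2`, as the
  -- closed formula requires.
  have hprod : (L * M ^ 2 + 1) * ((y₁ - 2) * (y₂ - 2)) = (L - 1) * (M ^ 2 - 1) := by
    linear_combination hmul - 2 * hadd
  have hne : (y₁ - 2) * (y₂ - 2) ≠ 0 := by
    intro h
    rw [h, mul_zero] at hprod
    exact mul_ne_zero hL1 hM1 hprod.symm
  rw [pFormula_eq n h2 hM hr0 hr (left_ne_zero_of_mul hne) hy₁,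
    pFormula_eq n h2 hM hr0 hr (right_ne_zero_of_mul hne) hy₂, eliminant_eq_mul n hadd hmul, ← hr,
    ← pow_mul]
  ring

end Riley

/-! ### Plane curves -/

/-- If `G` vanishes on `E`, then `G * H` vanishes on the whole curve `F = 0`. By the Nullstellensatz
`F` divides `G * H`, hence `G`. -/
theorem vanishingIdeal_le_span_of_irreducible {E : Set (Fin 2 → ℂ)} {F H : MvPolynomial (Fin 2) ℂ}
    (hF : Irreducible F) (hH : ¬ F ∣ H) (h : ∀ v, eval v F = 0 → eval v H ≠ 0 → v ∈ E) :
    vanishingIdeal ℂ E ≤ Ideal.span {F} := by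
  have hp : (Ideal.span {F}).IsPrime := (Ideal.span_singleton_prime hF.ne_zero).2 hF.prime
  intro G hG
  have : G * H ∈ vanishingIdeal ℂ (zeroLocus ℂ (Ideal.span {F})) := by
    rw [mem_vanishingIdeal_iff]
    intro v hv
    have hv' : eval v F = 0 := by
      simpa using (mem_zeroLocus_iff.1 hv) F (Ideal.mem_span_singleton_self F)
    by_cases hH' : eval v H = 0
    · simp [aeval_eq_eval, hH']
    · have := (mem_vanishingIdeal_iff.1 hG) v (h v hv' hH')
      rw [map_mul, this, zero_mul]
  rw [vanishingIdeal_zeroLocus_eq_radical, hp.radical, Ideal.mem_span_singleton] at this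
  rw [Ideal.mem_span_singleton]
  exact (hF.prime.dvd_or_dvd this).resolve_right hH

theorem isCurveComponent_of_irreducible {E : Set (Fin 2 → ℂ)} {F H G : MvPolynomial (Fin 2) ℂ}
    (hF : Irreducible F) (hH : ¬ F ∣ H) (h : ∀ v, eval v F = 0 → eval v H ≠ 0 → v ∈ E)
    (hG0 : G ≠ 0) (hG : ∀ v ∈ E, eval v G = 0) : IsCurveComponent E F := by
  have hp : (Ideal.span {F}).IsPrime := (Ideal.span_singleton_prime hF.ne_zero).2 hF.prime
  refine ⟨hF, ⟨hp, vanishingIdeal_le_span_of_irreducible hF hH h⟩, ?_⟩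
  rintro q ⟨hq, hEq⟩ hqF
  have hGq : G ∈ q := hEq (mem_vanishingIdeal_iff.2 fun v hv => by simpa using hG v hv)
  have hq0 : q ≠ ⊥ := by
    rintro rfl
    exact hG0 (by simpa using hGq)
  -- In a factorial ring a nonzero prime ideal contains a prime element. Inside `(F)` that element
  -- is associated to `F`, which gives minimality.
  obtain ⟨x, hxq, hx⟩ := hq.exists_mem_prime_of_ne_bot hq0
  have hFx : F ∣ x := Ideal.mem_span_singleton.1 (hqF hxq)
  have : x ∣ F := (hF.associated_of_dvd hx.irreducible hFx).symm.dvd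
  show Ideal.span {F} ≤ q
  rw [Ideal.span_singleton_le_iff_mem]
  exact q.mem_of_dvd this hxq

/-- Points off the curve `A = 0` are allowed if they lie on two curves `G₁ = 0` and `G₂ = 0` without
a common component: a component `F` divides both `A * G₁` and `A * G₂`, hence `A`. The unit value
bounds the content of `A`. -/
theorem definesCurvePart_of {E : Set (Fin 2 → ℂ)} {A : PolyLM} {G₁ G₂ : MvPolynomial (Fin 2) ℂ}
    (hunit : ∃ v : Fin 2 → ℤ, IsUnit (aeval v A)) (hG₁ : G₁ ≠ 0)
    (hG : ∀ F, Irreducible F → F ∣ G₁ → ¬ F ∣ G₂)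
    (hE : ∀ v ∈ E, aeval v A = 0 ∨ eval v G₁ = 0 ∧ eval v G₂ = 0)
    (hA : ∀ F, Irreducible F → F ∣ map (Int.castRingHom ℂ) A →
      ∃ H, ¬ F ∣ H ∧ ∀ v, eval v F = 0 → eval v H ≠ 0 → v ∈ E) :
    DefinesCurvePart E A := by
  obtain ⟨v₀, hv₀⟩ := hunit
  have hev : ∀ v : Fin 2 → ℂ, eval v (map (Int.castRingHom ℂ) A) = aeval v A := by
    intro v
    rw [eval_map, aeval_def]; rfl
  have hA0 : map (Int.castRingHom ℂ) A ≠ 0 := by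
    intro h
    have hinj := map_injective (σ := Fin 2) (Int.castRingHom ℂ) Int.cast_injective
    rw [← map_zero (map (Int.castRingHom ℂ))] at h
    rw [hinj h] at hv₀
    simp at hv₀
  have hE₁ : ∀ v ∈ E, eval v (map (Int.castRingHom ℂ) A * G₁) = 0 := by
    intro v hv
    rw [map_mul, hev]
    rcases hE v hv with h | h
    · rw [h, zero_mul]
    · rw [h.1, mul_zero]
  have hE₂ : ∀ v ∈ E, eval v (map (Int.castRingHom ℂ) A * G₂) = 0 := by
    intro v hv
    rw [map_mul, hev]
    rcases hE v hv with h | h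
    · rw [h, zero_mul]
    · rw [h.2, mul_zero]
  refine ⟨?_, fun F hF => ⟨?_, ?_⟩⟩
  · rintro c ⟨B, rfl⟩
    rw [map_mul, aeval_C] at hv₀
    simpa using isUnit_of_mul_isUnit_left hv₀
  · intro hFA
    obtain ⟨H, hH, h⟩ := hA F hF hFA
    exact isCurveComponent_of_irreducible hF hH h (mul_ne_zero hA0 hG₁) hE₁
  · rintro ⟨-, ⟨-, hle⟩, -⟩
    have m₁ : F ∣ map (Int.castRingHom ℂ) A * G₁ := Ideal.mem_span_singleton.1
      (hle (mem_vanishingIdeal_iff.2 fun v hv => by simpa using hE₁ v hv))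
    have m₂ : F ∣ map (Int.castRingHom ℂ) A * G₂ := Ideal.mem_span_singleton.1
      (hle (mem_vanishingIdeal_iff.2 fun v hv => by simpa using hE₂ v hv))
    rcases hF.prime.dvd_or_dvd m₁ with h | h₁
    · exact h
    · rcases hF.prime.dvd_or_dvd m₂ with h | h₂
      · exact h
      · exact absurd h₂ (hG F hF h₁)

/-! ### Pairs of meridians -/

section Group

variable {G : Type*} [Group G]

/-- The product around the four-crossing twist region. -/
def twistS (a c : G) : G := c * a⁻¹

/-- The product around the other twist region. -/
def twistR (a c : G) : G := a⁻¹ * twistS a c ^ 2 * a * (twistS a c ^ 2)⁻¹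

/-- The longitude in terms of two meridians. -/
def pairLongitude (n : ℤ) (a c : G) : G :=
  (twistR a c ^ n)⁻¹ * (twistS a c ^ 2)⁻¹ * twistR a c ^ n * twistS a c ^ 2

theorem map_twistR {G' : Type*} [Group G'] (f : G →* G') (a c : G) :
    f (twistR a c) = twistR (f a) (f c) := by
  simp [twistR, twistS]

theorem map_pairLongitude {G' : Type*} [Group G'] (f : G →* G') (n : ℤ) (a c : G) :
    f (pairLongitude n a c) = pairLongitude n (f a) (f c) := by
  simp [pairLongitude, twistS, map_twistR]

theorem mul_twistR (a c : G) : c * twistR a c = twistS a c ^ 2 * c * (twistS a c ^ 2)⁻¹ := by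
  have h : twistS a c * a = c := by simp [twistS]
  calc c * twistR a c = c * a⁻¹ * twistS a c ^ 2 * a * (twistS a c ^ 2)⁻¹ := by
        simp only [twistR]; group
    _ = twistS a c * twistS a c ^ 2 * a * (twistS a c ^ 2)⁻¹ := rfl
    _ = twistS a c ^ 2 * (twistS a c * a) * (twistS a c ^ 2)⁻¹ := by group
    _ = _ := by rw [h]

theorem twistS_conj (a c : G) : twistS a c ^ 2 * a * (twistS a c ^ 2)⁻¹ = a * twistR a c := by
  simp only [twistR]; group

/-- Conjugation by `S ^ 2` takes `a` to `a * R` and `c` to `c * R`, and the relation says that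
conjugation by `R ^ n` takes `a` to `c`. So `Λ` carries `a` around a closed loop of conjugations. -/
theorem pairLongitude_commute {n : ℤ} {a c : G} (h : c * twistR a c ^ n = twistR a c ^ n * a) :
    pairLongitude n a c * a = a * pairLongitude n a c := by
  set s := twistS a c ^ 2 with hs
  set r := twistR a c with hr
  have h1 : s * a = a * r * s := by
    rw [← twistS_conj]; simp [← hs]
  have h2 : s⁻¹ * (c * r) = c * s⁻¹ := by
    rw [mul_twistR]; simp [← hs, mul_assoc]
  have h3 : r ^ n * r = r * r ^ n := (Commute.zpow_self r n).eq
  have h4 : (r ^ n)⁻¹ * c = a * (r ^ n)⁻¹ := by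
    rw [inv_mul_eq_iff_eq_mul, ← mul_assoc, ← h, mul_inv_cancel_right]
  have : pairLongitude n a c = (r ^ n)⁻¹ * s⁻¹ * r ^ n * s := rfl
  rw [this]
  calc (r ^ n)⁻¹ * s⁻¹ * r ^ n * s * a = (r ^ n)⁻¹ * s⁻¹ * r ^ n * (s * a) := by group
    _ = (r ^ n)⁻¹ * s⁻¹ * (r ^ n * a) * r * s := by rw [h1]; group
    _ = (r ^ n)⁻¹ * s⁻¹ * c * (r ^ n * r) * s := by rw [← h]; group
    _ = (r ^ n)⁻¹ * (s⁻¹ * (c * r)) * r ^ n * s := by rw [h3]; group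
    _ = ((r ^ n)⁻¹ * c) * s⁻¹ * r ^ n * s := by rw [h2]; group
    _ = _ := by rw [h4]; group

end Group

/-! ### Pairs of matrices -/

section Matrices

open Polynomial.Chebyshev (S)

variable {K : Type*} [Field K]

/-- Cayley–Hamilton: powers of `g` satisfy the recursion of the Chebyshev polynomials at the trace,
in both directions. -/
theorem SL2_zpow_eq (g : Matrix.SpecialLinearGroup (Fin 2) K) (n : ℤ) :
    ((g ^ n : Matrix.SpecialLinearGroup (Fin 2) K) : Matrix (Fin 2) (Fin 2) K) =
      (S K (n - 1)).eval g.1.trace • g.1 - (S K (n - 2)).eval g.1.trace • 1 := by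
  have hdet := g.2
  rw [Matrix.det_fin_two] at hdet
  induction n using Int.induction_on with
  | zero => simp
  | succ n ih =>
    have E := congrArg (Polynomial.eval g.1.trace) (Polynomial.Chebyshev.S_eq K n)
    simp only [Polynomial.eval_sub, Polynomial.eval_mul, Polynomial.eval_X] at E
    rw [zpow_add_one, Matrix.SpecialLinearGroup.coe_mul, ih, add_sub_cancel_right,
      show (n : ℤ) + 1 - 2 = n - 1 by ring, E, Matrix.trace_fin_two]
    ext i j
    fin_cases i <;> fin_cases j <;> simp [Matrix.mul_apply, Fin.sum_univ_two] <;>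
      first
      | ring1
      | linear_combination (-(S K (n - 1)).eval (g.1 0 0 + g.1 1 1)) * hdet
  | pred n ih =>
    have E := congrArg (Polynomial.eval g.1.trace) (Polynomial.Chebyshev.S_sub_two K (-n - 1))
    simp only [Polynomial.eval_sub, Polynomial.eval_mul, Polynomial.eval_X] at E
    rw [zpow_sub_one, Matrix.SpecialLinearGroup.coe_mul, ih,
      show -(n : ℤ) - 1 - 1 = -n - 2 by ring, E, Matrix.trace_fin_two,
      Matrix.SpecialLinearGroup.coe_inv, Matrix.adjugate_fin_two,
      show -(n : ℤ) - 1 - 1 = -n - 2 by ring]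
    ext i j
    fin_cases i <;> fin_cases j <;> simp [Matrix.mul_apply, Fin.sum_univ_two] <;>
      first
      | ring1
      | linear_combination ((S K (-n - 1)).eval (g.1 0 0 + g.1 1 1)) * hdet

end Matrices

section MatrixPairs

theorem matrix_two_congr {K : Type*} {w x y z w' x' y' z' : K} (hw : w = w') (hx : x = x')
    (hy : y = y') (hz : z = z') : !![w, x; y, z] = !![w', x'; y', z'] := by
  rw [hw, hx, hy, hz]

open Polynomial.Chebyshev (S)
open Riley

variable {K : Type*} [Field K]

/-- Two matrices of determinant one and the same trace, the first one diagonal, and the trace of the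
product of the second one and the inverse of the first one. -/
structure MatrixPair (a c : Matrix.SpecialLinearGroup (Fin 2) K) (M p β γ δ y : K) : Prop where
  ne_zero : M ≠ 0
  left : a.1 = !![M, 0; 0, M⁻¹]
  right : c.1 = !![p, β; γ, δ]
  trace_eq : δ = M + M⁻¹ - p
  det_eq : β * γ = (p - M) * (M⁻¹ - p)
  y_eq : y = p * M⁻¹ + δ * M

namespace MatrixPair

variable {a c : Matrix.SpecialLinearGroup (Fin 2) K} {M p β γ δ y : K}

/-- Cayley–Hamilton for `c * a⁻¹`, whose trace is `y`. -/
theorem twistS_sq (h : MatrixPair a c M p β γ δ y) :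
    (twistS a c ^ 2).1 = !![y * p * M⁻¹ - 1, y * β * M; y * γ * M⁻¹, y * δ * M - 1] := by
  obtain ⟨hM, ha, hc, ht, hd, hy⟩ := h
  have hs : (twistS a c).1 = !![p * M⁻¹, β * M; γ * M⁻¹, δ * M] := by
    rw [twistS, Matrix.SpecialLinearGroup.coe_mul, Matrix.SpecialLinearGroup.coe_inv, ha, hc,
      Matrix.adjugate_fin_two_of, Matrix.mul_fin_two]
    simp
  have hMM : M * M⁻¹ = 1 := mul_inv_cancel₀ hM
  have e : ∀ x : K, β * x * (γ * M⁻¹) = (p - M) * (M⁻¹ - p) * (x * M⁻¹) := by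
    intro x; rw [← hd]; ring
  rw [pow_two, Matrix.SpecialLinearGroup.coe_mul, hs, Matrix.mul_fin_two]
  refine matrix_two_congr ?_ ?_ ?_ ?_
  · rw [e, hy, ht]; field_simp; ring
  · rw [hy]; ring
  · rw [hy]; ring
  · rw [show γ * M⁻¹ * (β * M) = (p - M) * (M⁻¹ - p) * (M * M⁻¹) by rw [← hd]; ring, hy, ht]
    field_simp; ring

theorem twistR_eq (h : MatrixPair a c M p β γ δ y) :
    (twistR a c).1 = !![1 + (1 - M⁻¹ ^ 2) * y ^ 2 * ((p - M) * (M⁻¹ - p)),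
      (M⁻¹ ^ 2 - 1) * (y * p * M⁻¹ - 1) * (y * β * M);
      (M ^ 2 - 1) * (y * γ * M⁻¹) * (y * δ * M - 1),
      1 + (1 - M ^ 2) * y ^ 2 * ((p - M) * (M⁻¹ - p))] := by
  have hσ := h.twistS_sq
  obtain ⟨hM, ha, hc, ht, hd, hy⟩ := h
  have hMM : M * M⁻¹ = 1 := mul_inv_cancel₀ hM
  have h14 : (y * p * M⁻¹ - 1) * (y * δ * M - 1) = 1 + y ^ 2 * ((p - M) * (M⁻¹ - p)) := by
    rw [hy, ht]; field_simp; ring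
  have h23 : (y * β * M) * (y * γ * M⁻¹) = y ^ 2 * ((p - M) * (M⁻¹ - p)) := by
    rw [← hd]; field_simp
  rw [twistR, Matrix.SpecialLinearGroup.coe_mul, Matrix.SpecialLinearGroup.coe_mul,
    Matrix.SpecialLinearGroup.coe_mul, Matrix.SpecialLinearGroup.coe_inv,
    Matrix.SpecialLinearGroup.coe_inv, hσ, ha, Matrix.adjugate_fin_two_of,
    Matrix.adjugate_fin_two_of, Matrix.mul_fin_two, Matrix.mul_fin_two, Matrix.mul_fin_two]
  generalize y * p * M⁻¹ - 1 = σ₁ at *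
  generalize y * δ * M - 1 = σ₄ at *
  generalize y * β * M = σ₂ at *
  generalize y * γ * M⁻¹ = σ₃ at *
  generalize (p - M) * (M⁻¹ - p) = t at *
  generalize M⁻¹ = N at *
  refine matrix_two_congr ?_ ?_ ?_ ?_
  · linear_combination σ₁ * σ₄ * hMM + h14 - N ^ 2 * h23
  · linear_combination (-σ₁ * σ₂) * hMM
  · linear_combination (-σ₃ * σ₄) * hMM
  · linear_combination σ₁ * σ₄ * hMM + h14 - M ^ 2 * h23

/-- The trace of `twistR` and the commutation defect of `twistR`. -/
theorem trace_twistR (h : MatrixPair a c M p β γ δ y) : (twistR a c).1.trace =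
    2 + (y + 2 - (M + M⁻¹) ^ 2) * y ^ 2 * (y - 2) := by
  rw [h.twistR_eq, Matrix.trace_fin_two_of]
  obtain ⟨hM, ha, hc, ht, hd, hy⟩ := h
  rw [hy, ht]
  field_simp
  ring

/-- The scalar depends on `M` and `y` only. This is what reduces the four entries of the group
relation to one equation. -/
theorem twistR_defect (h : MatrixPair a c M p β γ δ y) {e τ : K} (he : e = y + 2 - (M + M⁻¹) ^ 2)
    (hτ : τ = (twistR a c).1.trace) :
    c.1 * (twistR a c).1 - (twistR a c).1 * a.1 = (τ - 1 + e * y * (y - 1)) • (c.1 - a.1) := by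
  rw [hτ, h.trace_twistR, h.twistR_eq, he]
  obtain ⟨hM, ha, hc, ht, hd, hy⟩ := h
  rw [ha, hc, Matrix.mul_fin_two, Matrix.mul_fin_two, Matrix.of_sub_of, Matrix.of_sub_of,
    Matrix.smul_of]
  have e1 : ∀ x z : K, β * (x * (y * γ * M⁻¹) * z) = (p - M) * (M⁻¹ - p) * x * y * M⁻¹ * z := by
    intro x z; rw [← hd]; ring
  have e2 : ∀ x z : K, γ * (x * z * (y * β * M)) = (p - M) * (M⁻¹ - p) * x * y * M * z := by
    intro x z; rw [← hd]; ring
  simp only [Matrix.sub_cons, Matrix.smul_cons, Matrix.head_cons, Matrix.tail_cons, sub_self,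
    Matrix.zero_empty, smul_eq_mul, Matrix.smul_empty]
  refine matrix_two_congr ?_ ?_ ?_ ?_
  · rw [e1, hy, ht]; field_simp; ring
  · rw [hy, ht]; field_simp; ring
  · rw [hy, ht]; field_simp; ring
  · rw [e2, hy, ht]; field_simp; ring

/-- The map `X ↦ c * X - X * a` is linear and sends both `R` and `1` to multiples of `c - a`. -/
theorem relation_defect (h : MatrixPair a c M p β γ δ y) (n : ℤ) {e τ : K}
    (he : e = y + 2 - (M + M⁻¹) ^ 2) (hτ : τ = (twistR a c).1.trace) :
    c.1 * (twistR a c ^ n).1 - (twistR a c ^ n).1 * a.1 =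
      ((S K (n - 1)).eval τ * (τ - 1 + e * y * (y - 1)) - (S K (n - 2)).eval τ) • (c.1 - a.1) := by
  rw [SL2_zpow_eq, ← hτ, sub_smul, mul_smul, ← h.twistR_defect he hτ, mul_sub, sub_mul,
    Matrix.mul_smul, Matrix.mul_smul, Matrix.smul_mul, Matrix.smul_mul, one_mul, mul_one,
    smul_sub, smul_sub]
  abel

theorem riley_eq_mul (h : MatrixPair a c M p β γ δ y) (n : ℤ) {e τ : K}
    (he : e = y + 2 - (M + M⁻¹) ^ 2) (hτ : τ = (twistR a c).1.trace) :
    riley n (M ^ 2) y = (M ^ 2) ^ n.natAbs *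
      ((S K (n - 1)).eval τ * (τ - 1 + e * y * (y - 1)) - (S K (n - 2)).eval τ) := by
  refine riley_eq n y ?_ ?_
  · have := h.ne_zero
    rw [base, he]; field_simp; ring
  · rw [hτ, h.trace_twistR, he]

/-- The relation of the knot group holds exactly where the Riley polynomial vanishes. -/
theorem relation_iff (h : MatrixPair a c M p β γ δ y) (n : ℤ) (hac : c ≠ a) :
    c * twistR a c ^ n = twistR a c ^ n * a ↔ riley n (M ^ 2) y = 0 := by
  have hm : (M ^ 2) ^ n.natAbs ≠ 0 := pow_ne_zero _ (pow_ne_zero _ h.ne_zero)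
  have hne : c.1 - a.1 ≠ 0 := fun h0 => hac (Subtype.ext (sub_eq_zero.1 h0))
  rw [h.riley_eq_mul n rfl rfl, mul_eq_zero, or_iff_right hm, ← smul_eq_zero_iff_left hne,
    ← h.relation_defect n rfl rfl, sub_eq_zero, ← Matrix.SpecialLinearGroup.coe_mul,
    ← Matrix.SpecialLinearGroup.coe_mul]
  exact Subtype.ext_iff

theorem longitude_relation (h : MatrixPair a c M p β γ δ y) {n : ℤ}
    (hr : riley n (M ^ 2) y = 0) (hl : (pairLongitude n a c).1 1 0 = 0) :
    (M ^ 2 - 1) * (y * γ * M⁻¹) *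
      ((pairLongitude n a c).1 0 0 * (y * δ * M - 1) - (y * p * M⁻¹ - 1)) = 0 := by
  have hm : (M ^ 2) ^ n.natAbs ≠ 0 := pow_ne_zero _ (pow_ne_zero _ h.ne_zero)
  rw [h.riley_eq_mul n rfl rfl, mul_eq_zero, or_iff_right hm] at hr
  have hw := SL2_zpow_eq (twistR a c) n
  -- If this Chebyshev value were zero, the Riley equation would kill the other coefficient too, and
  -- `R ^ n` would be the zero matrix.
  have hα : (S K (n - 1)).eval (twistR a c).1.trace ≠ 0 := by
    intro h0
    rw [h0, zero_mul, zero_sub, neg_eq_zero] at hr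
    rw [h0, hr] at hw
    have := (twistR a c ^ n).2
    rw [hw] at this
    simp at this
  generalize (S K (n - 1)).eval (twistR a c).1.trace = α at *
  generalize (S K (n - 2)).eval (twistR a c).1.trace = ε at *
  have hcomm : twistS a c ^ 2 * twistR a c ^ n * pairLongitude n a c =
      twistR a c ^ n * twistS a c ^ 2 := by
    rw [pairLongitude]; group
  have hcomm' := congrArg Subtype.val hcomm
  rw [Matrix.SpecialLinearGroup.coe_mul, Matrix.SpecialLinearGroup.coe_mul,
    Matrix.SpecialLinearGroup.coe_mul, hw, h.twistS_sq, h.twistR_eq] at hcomm'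
  obtain ⟨hM, ha, hc, ht, hd, hy⟩ := h
  have hMM : M * M⁻¹ = 1 := mul_inv_cancel₀ hM
  have h14 : (y * p * M⁻¹ - 1) * (y * δ * M - 1) = 1 + y ^ 2 * ((p - M) * (M⁻¹ - p)) := by
    rw [hy, ht]; field_simp; ring
  have h23 : (y * β * M) * (y * γ * M⁻¹) = y ^ 2 * ((p - M) * (M⁻¹ - p)) := by
    rw [← hd]; field_simp
  have c0 := congrFun (congrFun hcomm' 0) 0
  have c1 := congrFun (congrFun hcomm' 1) 0
  simp [Matrix.mul_apply, Matrix.vecMul, dotProduct, Fin.sum_univ_two, hl] at c0 c1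
  generalize y * p * M⁻¹ - 1 = σ₁ at *
  generalize y * δ * M - 1 = σ₄ at *
  generalize y * β * M = σ₂ at *
  generalize y * γ * M⁻¹ = σ₃ at *
  generalize (pairLongitude n a c).1 0 0 = L at *
  apply mul_left_cancel₀ hα
  -- The first column of `S ^ 2` is `(σ₁, σ₃)`, so this combination removes the multiple `ε` of the
  -- identity in `R ^ n`. What is left is proportional to `α`, hence independent of `n`.
  linear_combination σ₁ * c1 - σ₃ * c0 - α * (M ^ 2 - 1) * σ₃ * (L * σ₄ - σ₁) * (h14 - h23) +
    α * σ₁ * σ₃ * (M ^ 2 - M⁻¹ ^ 2) * h23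

theorem quadratic_eq (h : MatrixPair a c M p β γ δ y) (L : K) :
    (L * M ^ 2 + 1) * y ^ 2 - (L + 1) * (M ^ 2 + 1) * y - (L - 1) * (M ^ 2 - 1) =
      (M ^ 2 - 1) * (L * (y * δ * M - 1) - (y * p * M⁻¹ - 1)) := by
  obtain ⟨hM, ha, hc, ht, hd, hy⟩ := h
  rw [hy, ht]
  field_simp
  ring

/-- All matrices are upper triangular here, their diagonal entries commute, and the longitude is a
commutator. -/
theorem longitude_eq_one (h : MatrixPair a c M p β γ δ y) {n : ℤ} (hγ : γ = 0)
    (hl : (pairLongitude n a c).1 1 0 = 0) : (pairLongitude n a c).1 0 0 = 1 := by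
  have hs : (twistS a c ^ 2).1 1 0 = 0 := by rw [h.twistS_sq]; simp [hγ]
  have hw : (twistR a c ^ n).1 1 0 = 0 := by
    rw [SL2_zpow_eq, h.twistR_eq]; simp [hγ]
  have hcomm : twistS a c ^ 2 * twistR a c ^ n * pairLongitude n a c =
      twistR a c ^ n * twistS a c ^ 2 := by
    rw [pairLongitude]; group
  have c0 := congrFun (congrFun (congrArg Subtype.val hcomm) 0) 0
  have d1 := (twistS a c ^ 2).2
  have d2 := (twistR a c ^ n).2
  rw [Matrix.det_fin_two, hs, mul_zero, sub_zero] at d1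
  rw [Matrix.det_fin_two, hw, mul_zero, sub_zero] at d2
  simp only [Matrix.SpecialLinearGroup.coe_mul, Matrix.mul_apply, Fin.sum_univ_two, hl, hw, hs,
    mul_zero, add_zero] at c0
  have h1 := left_ne_zero_of_mul_eq_one d1
  have h2 := left_ne_zero_of_mul_eq_one d2
  apply mul_left_cancel₀ (mul_ne_zero h1 h2)
  rw [c0]; ring

theorem eliminant_longitude (h : MatrixPair a c M p β γ δ y) {n : ℤ} (hac : c ≠ a)
    (hrel : c * twistR a c ^ n = twistR a c ^ n * a) (hl : (pairLongitude n a c).1 1 0 = 0) :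
    eliminant n ((pairLongitude n a c).1 0 0) (M ^ 2) = 0 := by
  have hr := (h.relation_iff n hac).1 hrel
  have hm : (M ^ 2) ^ n.natAbs ≠ 0 := pow_ne_zero _ (pow_ne_zero _ h.ne_zero)
  refine eliminant_eq_zero n ?_ hr
  have hL := h.longitude_relation hr hl
  have hy : y ≠ 0 := by
    rintro rfl
    rw [riley_zero_right] at hr
    exact hm hr
  by_cases hγ : γ = 0
  · rw [h.longitude_eq_one hγ hl]
    have hd := h.det_eq
    rw [hγ, mul_zero] at hd
    -- A triangular `c` has the diagonal of `a` or the reversed one. In the first case `y = 2`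
    -- solves the quadratic at `L = 1`; in the second `base` vanishes, against the Riley equation.
    rcases mul_eq_zero.1 hd.symm with hp | hp
    · have hy2 : y = 2 := by
        rw [h.y_eq, h.trace_eq, sub_eq_zero.1 hp]
        have := h.ne_zero
        field_simp; ring
      rw [hy2]; ring
    · exfalso
      have hb : base (M ^ 2) y = 0 := by
        rw [base, h.y_eq, h.trace_eq, ← sub_eq_zero.1 hp]
        have := h.ne_zero
        field_simp; ring
      rw [riley_of_gap_eq_zero n (by rw [hb]; ring) (by rw [hb]; ring)] at hr
      exact hm hr
  · rw [h.quadratic_eq]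
    have h3 : y * γ * M⁻¹ ≠ 0 := mul_ne_zero (mul_ne_zero hy hγ) (inv_ne_zero h.ne_zero)
    apply mul_left_cancel₀ h3
    linear_combination hL

end MatrixPair

theorem exists_matrixPair {n : ℤ} {L M y : ℂ} (hM : M ≠ 0) (hM1 : M ^ 2 - 1 ≠ 0) (hM2 : M ^ 2 + 1 ≠ 0)
    (hq : (L * M ^ 2 + 1) * y ^ 2 - (L + 1) * (M ^ 2 + 1) * y - (L - 1) * (M ^ 2 - 1) = 0)
    (hr : riley n (M ^ 2) y = 0) :
    ∃ a c : Matrix.SpecialLinearGroup (Fin 2) ℂ, c * twistR a c ^ n = twistR a c ^ n * a ∧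
      a * c ≠ c * a ∧ a.1 1 0 = 0 ∧ a.1 0 0 = M ∧ (pairLongitude n a c).1 1 0 = 0 ∧
      (pairLongitude n a c).1 0 0 = L := by
  have hM1' : 1 - M ^ 2 ≠ 0 := by rwa [← neg_sub, neg_ne_zero]
  -- Obtained by solving `y = p * M⁻¹ + (M + M⁻¹ - p) * M` for `p`; the lower left entry is
  -- normalized to `1`, which also makes the pair nonabelian.
  set p := M * (y - M ^ 2 - 1) / (1 - M ^ 2) with hp
  set δ := M + M⁻¹ - p with hδ
  set β := (p - M) * (M⁻¹ - p) with hβ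
  obtain ⟨a, ha⟩ : ∃ a : Matrix.SpecialLinearGroup (Fin 2) ℂ, a.1 = !![M, 0; 0, M⁻¹] :=
    ⟨⟨!![M, 0; 0, M⁻¹], by rw [Matrix.det_fin_two_of]; field_simp; ring⟩, rfl⟩
  obtain ⟨c, hc⟩ : ∃ c : Matrix.SpecialLinearGroup (Fin 2) ℂ, c.1 = !![p, β; 1, δ] :=
    ⟨⟨!![p, β; 1, δ], by rw [Matrix.det_fin_two_of, hβ, hδ]; field_simp; ring⟩, rfl⟩
  have h : MatrixPair a c M p β 1 δ y :=
    ⟨hM, ha, hc, rfl, by rw [hβ, mul_one], by rw [hδ, hp]; field_simp; ring⟩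
  have hnc : a * c ≠ c * a := by
    intro hcom
    have := congrFun (congrFun (congrArg Subtype.val hcom) 1) 0
    simp only [Matrix.SpecialLinearGroup.coe_mul, ha, hc, Matrix.mul_fin_two] at this
    simp at this
    apply hM1
    rw [pow_two]
    nth_rewrite 1 [← this]
    rw [inv_mul_cancel₀ hM, sub_self]
  have hac : c ≠ a := by rintro rfl; exact hnc rfl
  have hrel := (h.relation_iff n hac).2 hr
  have hcomm := pairLongitude_commute hrel
  have hl : (pairLongitude n a c).1 1 0 = 0 := by
    have := congrFun (congrFun (congrArg Subtype.val hcomm) 1) 0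
    simp only [Matrix.SpecialLinearGroup.coe_mul, ha, Matrix.mul_apply, Fin.sum_univ_two] at this
    simp at this
    have h' : (M ^ 2 - 1) * (pairLongitude n a c).1 1 0 = 0 := by
      have h2 : M * ((pairLongitude n a c).1 1 0 * M) = (pairLongitude n a c).1 1 0 := by
        rw [this, ← mul_assoc, mul_inv_cancel₀ hM, one_mul]
      linear_combination h2
    exact (mul_eq_zero.1 h').resolve_left hM1
  refine ⟨a, c, hrel, hnc, by rw [ha]; simp, by rw [ha]; simp, hl, ?_⟩
  have hy : y ≠ 0 := by
    rintro rfl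
    rw [riley_zero_right] at hr
    exact pow_ne_zero _ (pow_ne_zero _ hM) hr
  have hL := h.longitude_relation hr hl
  have h3 : (M ^ 2 - 1) * (y * 1 * M⁻¹) ≠ 0 :=
    mul_ne_zero hM1 (mul_ne_zero (mul_ne_zero hy one_ne_zero) (inv_ne_zero hM))
  have e1 := (mul_eq_zero.1 hL).resolve_left h3
  rw [h.quadratic_eq] at hq
  have e2 := (mul_eq_zero.1 hq).resolve_left hM1
  -- Otherwise both diagonal entries of `S ^ 2` vanish. Then `y ^ 2 = 2`, while the quadratic, now
  -- zero for every `L`, gives `y = 2` at `L = 1`; this uses `M ^ 2 ≠ -1`.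
  have h4 : y * δ * M - 1 ≠ 0 := by
    intro h0
    rw [h0] at e2
    have h1 : y * p * M⁻¹ - 1 = 0 := by linear_combination -e2
    have q0 := h.quadratic_eq 0
    have q1 := h.quadratic_eq 1
    rw [h0, h1] at q0 q1
    have hy2 : y ^ 2 = 2 := by
      have := h.y_eq
      linear_combination y * this + h0 + h1
    have : (M ^ 2 + 1) * (y * (y - 2)) = 0 := by linear_combination q1
    have hy3 : y = 2 := by
      have := ((mul_eq_zero.1 this).resolve_left hM2)
      linear_combination (mul_eq_zero.1 this).resolve_left hy
    rw [hy3] at hy2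
    norm_num at hy2
  apply mul_right_cancel₀ h4
  linear_combination e1 - e2

theorem eliminant_of_relation {n : ℤ} {a c : Matrix.SpecialLinearGroup (Fin 2) K}
    (hrel : c * twistR a c ^ n = twistR a c ^ n * a) (hac : c ≠ a) (ha : a.1 1 0 = 0)
    (hM1 : a.1 0 0 ^ 2 - 1 ≠ 0) (hl : (pairLongitude n a c).1 1 0 = 0) :
    eliminant n ((pairLongitude n a c).1 0 0) (a.1 0 0 ^ 2) = 0 := by
  have hdet := a.2
  rw [Matrix.det_fin_two, ha, mul_zero, sub_zero] at hdet
  set M := a.1 0 0 with hMdef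
  have hM : M ≠ 0 := left_ne_zero_of_mul_eq_one hdet
  have h11 : a.1 1 1 = M⁻¹ := eq_inv_of_mul_eq_one_right hdet
  -- Conjugation by the unipotent matrix with this entry diagonalizes `a`. It preserves lower left
  -- entries, and upper left entries of upper triangular matrices.
  set k := a.1 0 1 / (M - M⁻¹) with hk
  have hMM : M - M⁻¹ ≠ 0 := by
    intro h0
    apply hM1
    have : M * (M - M⁻¹) = 0 := by rw [h0, mul_zero]
    rw [mul_sub, mul_inv_cancel₀ hM] at this
    rw [← this]; ring
  obtain ⟨P, hP⟩ : ∃ P : Matrix.SpecialLinearGroup (Fin 2) K, P.1 = !![1, k; 0, 1] :=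
    ⟨⟨!![1, k; 0, 1], by rw [Matrix.det_fin_two_of]; ring⟩, rfl⟩
  have conj_val : ∀ g : Matrix.SpecialLinearGroup (Fin 2) K, (MulAut.conj P g).1 =
      !![g.1 0 0 + k * g.1 1 0, -k * (g.1 0 0 + k * g.1 1 0) + (g.1 0 1 + k * g.1 1 1);
        g.1 1 0, -k * g.1 1 0 + g.1 1 1] := by
    intro g
    rw [MulAut.conj_apply, Matrix.SpecialLinearGroup.coe_mul, Matrix.SpecialLinearGroup.coe_mul,
      Matrix.SpecialLinearGroup.coe_inv, hP, Matrix.adjugate_fin_two_of]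
    conv_lhs => rw [Matrix.eta_fin_two g.1]
    rw [Matrix.mul_fin_two, Matrix.mul_fin_two]
    refine matrix_two_congr ?_ ?_ ?_ ?_ <;> ring
  have hlon := map_pairLongitude (MulAut.conj P).toMonoidHom n a c
  have hrel' := congrArg (MulAut.conj P).toMonoidHom hrel
  rw [map_mul, map_mul, map_zpow, map_twistR] at hrel'
  have ha' : (MulAut.conj P a).1 = !![M, 0; 0, M⁻¹] := by
    rw [conj_val, ha, h11, ← hMdef]
    refine matrix_two_congr (by ring) ?_ rfl (by ring)
    rw [show a.1 0 1 = k * (M - M⁻¹) by rw [hk]; field_simp]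
    ring
  have htr : (MulAut.conj P c).1.trace = (MulAut.conj P a).1.trace := by
    have e : c = twistR a c ^ n * a * (twistR a c ^ n)⁻¹ := by rw [← hrel]; group
    have tr_conj : ∀ g h : Matrix.SpecialLinearGroup (Fin 2) K, (g * h * g⁻¹).1.trace = h.1.trace := by
      intro g h
      rw [Matrix.SpecialLinearGroup.coe_mul, Matrix.trace_mul_comm,
        ← Matrix.SpecialLinearGroup.coe_mul, inv_mul_cancel_left]
    rw [MulAut.conj_apply, MulAut.conj_apply, tr_conj, tr_conj]
    conv_lhs => rw [e]
    rw [tr_conj]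
  have hdetc := (MulAut.conj P c).2
  set c' := MulAut.conj P c with hc'
  set a' := MulAut.conj P a with ha''
  rw [ha', Matrix.trace_fin_two, Matrix.trace_fin_two_of] at htr
  rw [Matrix.det_fin_two] at hdetc
  have hpair : MatrixPair a' c' M (c'.1 0 0) (c'.1 0 1) (c'.1 1 0) (c'.1 1 1)
      (c'.1 0 0 * M⁻¹ + c'.1 1 1 * M) := by
    refine ⟨hM, ha', Matrix.eta_fin_two _, by linear_combination htr, ?_, rfl⟩
    have h' : c'.1 1 1 = M + M⁻¹ - c'.1 0 0 := by linear_combination htr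
    rw [h'] at hdetc
    linear_combination -hdetc + mul_inv_cancel₀ hM
  have hac' : c' ≠ a' := fun h0 => hac ((MulAut.conj P).injective h0)
  have hlon' : pairLongitude n a' c' = MulAut.conj P (pairLongitude n a c) := hlon.symm
  have hL := hpair.eliminant_longitude (n := n) hac' hrel' (by rw [hlon', conj_val]; simpa using hl)
  rw [hlon', conj_val] at hL
  simpa [hl] using hL

/-- With `M = ±1` the matrix `a` is not scalar, since otherwise the relation would force `c = a`. An
upper triangular matrix commuting with it has equal diagonal entries. -/
theorem parabolic_longitude {n : ℤ} {a c : Matrix.SpecialLinearGroup (Fin 2) K}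
    (hrel : c * twistR a c ^ n = twistR a c ^ n * a) (hac : c ≠ a) (ha : a.1 1 0 = 0)
    (hM1 : a.1 0 0 ^ 2 - 1 = 0) (hl : (pairLongitude n a c).1 1 0 = 0) :
    (pairLongitude n a c).1 0 0 ^ 2 - 1 = 0 := by
  have hdet := a.2
  rw [Matrix.det_fin_two, ha, mul_zero, sub_zero] at hdet
  have h11 : a.1 1 1 = a.1 0 0 := by
    have hM : a.1 0 0 ≠ 0 := left_ne_zero_of_mul_eq_one hdet
    apply mul_left_cancel₀ hM
    linear_combination hdet - hM1
  have hx : a.1 0 1 ≠ 0 := by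
    intro h0
    apply hac
    have hcentral : ∀ g : Matrix.SpecialLinearGroup (Fin 2) K, g * a = a * g := by
      intro g
      apply Subtype.ext
      have : a.1 = a.1 0 0 • 1 := by
        ext i j
        fin_cases i <;> fin_cases j <;> simp [ha, h0, h11]
      rw [Matrix.SpecialLinearGroup.coe_mul, Matrix.SpecialLinearGroup.coe_mul, this]
      simp
    rw [hcentral] at hrel
    exact mul_right_cancel hrel
  have hcomm := pairLongitude_commute hrel
  have hdl := (pairLongitude n a c).2
  rw [Matrix.det_fin_two, hl, mul_zero, sub_zero] at hdl
  have := congrFun (congrFun (congrArg Subtype.val hcomm) 0) 1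
  simp only [Matrix.SpecialLinearGroup.coe_mul, Matrix.mul_apply, Fin.sum_univ_two] at this
  rw [h11] at this
  apply mul_left_cancel₀ hx
  linear_combination (pairLongitude n a c).1 0 0 * this + a.1 0 1 * hdl

end MatrixPairs

/-! ### Colorings of the diagram -/

section TwistRegion

variable {G : Type*} [Group G]

/-- The meridians of the strands of a twist region in which the two strands run in opposite
directions and the crossings are negative. -/
def IsNegTwist (g h : ℕ → G) (K : ℕ) : Prop :=
  ∀ i < K, (Even i → g (i + 1) = g i ∧ h i = g i * h (i + 1) * (g i)⁻¹) ∧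
    (¬ Even i → h i = h (i + 1) ∧ g (i + 1) = h (i + 1) * g i * (h (i + 1))⁻¹)

/-- The same with positive crossings. -/
def IsPosTwist (g h : ℕ → G) (K : ℕ) : Prop :=
  ∀ i < K, (Even i → g (i + 1) = g i ∧ h i = (g i)⁻¹ * h (i + 1) * g i) ∧
    (¬ Even i → h i = h (i + 1) ∧ g (i + 1) = (h (i + 1))⁻¹ * g i * h (i + 1))

theorem conj_pow_succ (r : G) (j : ℕ) (x : G) :
    MulAut.conj (r ^ (j + 1)) x = MulAut.conj (r ^ j) (r * x * r⁻¹) := by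
  simp only [MulAut.conj_apply, pow_succ]; group

theorem isNegTwist_of {g h : ℕ → G} {K : ℕ} {x y r : G} (hr : x * r = y)
    (hgh : ∀ i ≤ K, g i = MulAut.conj (r ^ (i / 2)) x ∧ h i = MulAut.conj (r ^ ((i + 1) / 2)) y) :
    IsNegTwist g h K := by
  have hr' : r = x⁻¹ * y := by rw [← hr]; group
  intro i hi
  obtain ⟨g0, h0⟩ := hgh i (by omega)
  obtain ⟨g1, h1⟩ := hgh (i + 1) (by omega)
  refine ⟨fun he => ?_, fun ho => ?_⟩
  · obtain ⟨j, rfl⟩ := he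
    rw [show (j + j) / 2 = j by omega] at g0
    rw [show (j + j + 1) / 2 = j by omega] at h0 g1
    rw [show (j + j + 1 + 1) / 2 = j + 1 by omega, conj_pow_succ] at h1
    rw [g0, h0, g1, h1, ← map_inv, ← map_mul, ← map_mul, hr']
    exact ⟨rfl, congrArg _ (by group)⟩
  · obtain ⟨j, rfl⟩ := Nat.not_even_iff_odd.1 ho
    rw [show (2 * j + 1) / 2 = j by omega] at g0
    rw [show (2 * j + 1 + 1) / 2 = j + 1 by omega] at h0 g1
    rw [show (2 * j + 1 + 1 + 1) / 2 = j + 1 by omega] at h1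
    rw [conj_pow_succ] at g1 h1 h0
    rw [g0, h0, g1, h1, ← map_inv, ← map_mul, ← map_mul, hr']
    exact ⟨rfl, congrArg _ (by group)⟩

theorem isPosTwist_of {g h : ℕ → G} {K : ℕ} {x y r : G} (hr : r * y = x)
    (hgh : ∀ i ≤ K, g i = MulAut.conj (r ^ (i / 2)) x ∧ h i = MulAut.conj (r ^ ((i + 1) / 2)) y) :
    IsPosTwist g h K := by
  have hr' : r = x * y⁻¹ := by rw [← hr]; group
  intro i hi
  obtain ⟨g0, h0⟩ := hgh i (by omega)
  obtain ⟨g1, h1⟩ := hgh (i + 1) (by omega)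
  refine ⟨fun he => ?_, fun ho => ?_⟩
  · obtain ⟨j, rfl⟩ := he
    rw [show (j + j) / 2 = j by omega] at g0
    rw [show (j + j + 1) / 2 = j by omega] at h0 g1
    rw [show (j + j + 1 + 1) / 2 = j + 1 by omega, conj_pow_succ] at h1
    rw [g0, h0, g1, h1, ← map_inv, ← map_mul, ← map_mul, hr']
    exact ⟨rfl, congrArg _ (by group)⟩
  · obtain ⟨j, rfl⟩ := Nat.not_even_iff_odd.1 ho
    rw [show (2 * j + 1) / 2 = j by omega] at g0
    rw [show (2 * j + 1 + 1) / 2 = j + 1 by omega] at h0 g1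
    rw [show (2 * j + 1 + 1 + 1) / 2 = j + 1 by omega] at h1
    rw [conj_pow_succ] at g1 h1 h0
    rw [g0, h0, g1, h1, ← map_inv, ← map_mul, ← map_mul, hr']
    exact ⟨rfl, congrArg _ (by group)⟩

/-- The two strands are changed in turn, which accounts for the exponents `i / 2` and `(i + 1) / 2`;
every two crossings contribute one conjugation by `r`. -/
theorem IsNegTwist.eq {g h : ℕ → G} {K : ℕ} (H : IsNegTwist g h K) {r : G} (hr : g 0 * r = h 0) :
    ∀ i ≤ K, g i = MulAut.conj (r ^ (i / 2)) (g 0) ∧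
      h i = MulAut.conj (r ^ ((i + 1) / 2)) (h 0) := by
  have hr' : r = (g 0)⁻¹ * h 0 := by rw [← hr]; group
  intro i
  induction i with
  | zero => simp
  | succ i ih =>
    intro hi
    obtain ⟨g0, h0⟩ := ih (by omega)
    obtain ⟨he, ho⟩ := H i (by omega)
    by_cases hev : Even i
    · obtain ⟨g1, h1⟩ := he hev
      have h1' : h (i + 1) = (g i)⁻¹ * h i * g i := by rw [h1]; group
      obtain ⟨j, rfl⟩ := hev
      rw [show (j + j) / 2 = j by omega] at g0
      rw [show (j + j + 1) / 2 = j by omega] at h0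
      rw [g1, h1', show (j + j + 1) / 2 = j by omega, show (j + j + 1 + 1) / 2 = j + 1 by omega,
        conj_pow_succ, g0, h0, ← map_inv, ← map_mul, ← map_mul, hr']
      exact ⟨rfl, congrArg _ (by group)⟩
    · obtain ⟨h1, g1⟩ := ho hev
      obtain ⟨j, rfl⟩ := Nat.not_even_iff_odd.1 hev
      rw [show (2 * j + 1) / 2 = j by omega] at g0
      rw [show (2 * j + 1 + 1) / 2 = j + 1 by omega, conj_pow_succ] at h0
      rw [g1, ← h1, show (2 * j + 1 + 1) / 2 = j + 1 by omega,
        show (2 * j + 1 + 1 + 1) / 2 = j + 1 by omega, conj_pow_succ, conj_pow_succ, g0, h0,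
        ← map_inv, ← map_mul, ← map_mul, hr']
      exact ⟨congrArg _ (by group), rfl⟩

theorem IsPosTwist.eq {g h : ℕ → G} {K : ℕ} (H : IsPosTwist g h K) {r : G} (hr : r * h 0 = g 0) :
    ∀ i ≤ K, g i = MulAut.conj (r ^ (i / 2)) (g 0) ∧
      h i = MulAut.conj (r ^ ((i + 1) / 2)) (h 0) := by
  have hr' : r = g 0 * (h 0)⁻¹ := by rw [← hr]; group
  intro i
  induction i with
  | zero => simp
  | succ i ih =>
    intro hi
    obtain ⟨g0, h0⟩ := ih (by omega)
    obtain ⟨he, ho⟩ := H i (by omega)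
    by_cases hev : Even i
    · obtain ⟨g1, h1⟩ := he hev
      have h1' : h (i + 1) = g i * h i * (g i)⁻¹ := by rw [h1]; group
      obtain ⟨j, rfl⟩ := hev
      rw [show (j + j) / 2 = j by omega] at g0
      rw [show (j + j + 1) / 2 = j by omega] at h0
      rw [g1, h1', show (j + j + 1) / 2 = j by omega, show (j + j + 1 + 1) / 2 = j + 1 by omega,
        conj_pow_succ, g0, h0, ← map_inv, ← map_mul, ← map_mul, hr']
      exact ⟨rfl, congrArg _ (by group)⟩
    · obtain ⟨h1, g1⟩ := ho hev
      obtain ⟨j, rfl⟩ := Nat.not_even_iff_odd.1 hev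
      rw [show (2 * j + 1) / 2 = j by omega] at g0
      rw [show (2 * j + 1 + 1) / 2 = j + 1 by omega, conj_pow_succ] at h0
      rw [g1, ← h1, show (2 * j + 1 + 1) / 2 = j + 1 by omega,
        show (2 * j + 1 + 1 + 1) / 2 = j + 1 by omega, conj_pow_succ, conj_pow_succ, g0, h0,
        ← map_inv, ← map_mul, ← map_mul, hr']
      exact ⟨congrArg _ (by group), rfl⟩

end TwistRegion

namespace ConwayKnot

variable {G : Type*} [Group G]

theorem even_k (n : ℤ) : Even (k n) := ⟨n.natAbs, by unfold k; ring⟩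

theorem overPass_of {n : ℤ} {c : Fin (k n + 4)} (h : FirstIsOver n c) :
    overPass n c = firstPass n c ∧ underPass n c = secondPass n c := by
  simp [overPass, underPass, h]

theorem overPass_of_not {n : ℤ} {c : Fin (k n + 4)} (h : ¬ FirstIsOver n c) :
    overPass n c = secondPass n c ∧ underPass n c = firstPass n c := by
  simp [overPass, underPass, h]

theorem sign_neg {n : ℤ} {c : Fin (k n + 4)} (hc : (c : ℕ) < k n) (hn : 0 < n) :
    (((knot n).sign c : ℤˣ) : ℤ) = -1 := by
  simp [knot, hc, hn]

theorem sign_pos {n : ℤ} {c : Fin (k n + 4)} (hc : ¬ ((c : ℕ) < k n ∧ 0 < n)) :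
    (((knot n).sign c : ℤˣ) : ℤ) = 1 := by
  simp [knot, hc]

theorem firstIsOver_of_pos {n : ℤ} {c : Fin (k n + 4)} (hc : (c : ℕ) < k n) (hn : 0 < n) :
    FirstIsOver n c ↔ Even (c : ℕ) := by
  simp [FirstIsOver, hc, hn]

theorem firstIsOver_of_not_pos {n : ℤ} {c : Fin (k n + 4)} (hc : (c : ℕ) < k n) (hn : ¬ 0 < n) :
    FirstIsOver n c ↔ ¬ Even (c : ℕ) := by
  simp [FirstIsOver, hc, hn]

theorem firstIsOver_of_le {n : ℤ} {c : Fin (k n + 4)} (hc : ¬ (c : ℕ) < k n) :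
    FirstIsOver n c ↔ Even (c : ℕ) := by
  simp [FirstIsOver, hc]

theorem secondPass_of_lt {n : ℤ} {c : Fin (k n + 4)} (hc : (c : ℕ) < k n) :
    secondPass n c = 2 * k n + 4 - (c + 1) ∧ secondPass n c + 1 = 2 * k n + 4 - c := by
  simp only [secondPass, hc, if_true]; omega

theorem secondPass_of_le {n : ℤ} {c : Fin (k n + 4)} {j : ℕ} (hc : (c : ℕ) = k n + j) :
    secondPass n c = 2 * k n + 8 - (j + 1) ∧ secondPass n c + 1 = 2 * k n + 8 - j := by
  have := c.2
  have h : ¬ (c : ℕ) < k n := by omega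
  simp only [secondPass, h, if_false]; omega

/-- The relations at the crossing `c`. -/
def IsColoringAt (n : ℤ) (x : ℕ → G) (c : Fin (k n + 4)) : Prop :=
  x (overPass n c + 1) = x (overPass n c) ∧
    x (underPass n c + 1) = x (overPass n c) ^ (-((knot n).sign c : ℤ)) * x (underPass n c) *
      x (overPass n c) ^ ((knot n).sign c : ℤ)

theorem isColoringAt_of_pos {n : ℤ} (x : ℕ → G) {c : Fin (k n + 4)} (hc : (c : ℕ) < k n)
    (hn : 0 < n) : IsColoringAt n x c ↔
      (Even (c : ℕ) → x (c + 1) = x c ∧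
        x (2 * k n + 4 - c) = x c * x (2 * k n + 4 - (c + 1)) * (x c)⁻¹) ∧
      (¬ Even (c : ℕ) → x (2 * k n + 4 - c) = x (2 * k n + 4 - (c + 1)) ∧
        x (c + 1) = x (2 * k n + 4 - (c + 1)) * x c * (x (2 * k n + 4 - (c + 1)))⁻¹) := by
  obtain ⟨h2, h2'⟩ := secondPass_of_lt hc
  unfold IsColoringAt
  rw [sign_neg hc hn]
  by_cases he : Even (c : ℕ)
  · obtain ⟨h3, h4⟩ := overPass_of ((firstIsOver_of_pos hc hn).2 he)
    rw [h3, h4, h2', h2]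
    simp [he, firstPass]
  · obtain ⟨h3, h4⟩ := overPass_of_not (mt (firstIsOver_of_pos hc hn).1 he)
    rw [h3, h4, h2', h2]
    simp [he, firstPass]

theorem isColoringAt_of_not_pos {n : ℤ} (x : ℕ → G) {c : Fin (k n + 4)} (hc : (c : ℕ) < k n)
    (hn : ¬ 0 < n) : IsColoringAt n x c ↔
      (Even (c : ℕ) → x (2 * k n + 4 - (c + 1)) = x (2 * k n + 4 - c) ∧
        x c = x (2 * k n + 4 - c) * x (c + 1) * (x (2 * k n + 4 - c))⁻¹) ∧
      (¬ Even (c : ℕ) → x c = x (c + 1) ∧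
        x (2 * k n + 4 - (c + 1)) = x (c + 1) * x (2 * k n + 4 - c) * (x (c + 1))⁻¹) := by
  obtain ⟨h2, h2'⟩ := secondPass_of_lt hc
  unfold IsColoringAt
  rw [sign_pos (by tauto)]
  by_cases he : Even (c : ℕ)
  · obtain ⟨h3, h4⟩ := overPass_of_not (mt (firstIsOver_of_not_pos hc hn).1 (not_not.2 he))
    rw [h3, h4, h2', h2]
    simp only [he, firstPass, true_imp_iff, not_true, false_imp_iff, and_true, zpow_neg, zpow_one]
    constructor
    · rintro ⟨h, h'⟩
      refine ⟨h.symm, ?_⟩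
      rw [h', h]; group
    · rintro ⟨h, h'⟩
      refine ⟨h.symm, ?_⟩
      rw [h, h']; group
  · obtain ⟨h3, h4⟩ := overPass_of ((firstIsOver_of_not_pos hc hn).2 he)
    rw [h3, h4, h2', h2]
    simp only [he, firstPass, true_imp_iff, not_false_iff, false_imp_iff, true_and, zpow_neg,
      zpow_one]
    constructor
    · rintro ⟨h, h'⟩
      refine ⟨h.symm, ?_⟩
      rw [h', h]; group
    · rintro ⟨h, h'⟩
      refine ⟨h.symm, ?_⟩
      rw [h', ← h]; group

theorem isColoringAt_of_le {n : ℤ} (x : ℕ → G) {c : Fin (k n + 4)} {j : ℕ}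
    (hc : (c : ℕ) = k n + j) : IsColoringAt n x c ↔
      (Even j → x (k n + (j + 1)) = x (k n + j) ∧
        x (2 * k n + 8 - j) = (x (k n + j))⁻¹ * x (2 * k n + 8 - (j + 1)) * x (k n + j)) ∧
      (¬ Even j → x (2 * k n + 8 - j) = x (2 * k n + 8 - (j + 1)) ∧
        x (k n + (j + 1)) =
          (x (2 * k n + 8 - (j + 1)))⁻¹ * x (k n + j) * x (2 * k n + 8 - (j + 1))) := by
  obtain ⟨h2, h2'⟩ := secondPass_of_le hc
  have hlt : ¬ (c : ℕ) < k n := by omega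
  have hev : Even (c : ℕ) ↔ Even j := by
    rw [hc, Nat.even_add]; simp [even_k]
  unfold IsColoringAt
  rw [sign_pos (by tauto)]
  by_cases he : Even j
  · obtain ⟨h3, h4⟩ := overPass_of ((firstIsOver_of_le hlt).2 (hev.2 he))
    rw [h3, h4, h2', h2]
    simp [he, firstPass, hc, add_assoc]
  · obtain ⟨h3, h4⟩ := overPass_of_not (mt ((firstIsOver_of_le hlt).trans hev).1 he)
    rw [h3, h4, h2', h2]
    simp [he, firstPass, hc, add_assoc]

/-- A positive crossing read along its lower strand gives the relation of a negative one read
against it. So for `n ≤ 0` the first region is a negative twist with the roles of its two strands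
exchanged. -/
theorem isColoring_iff (n : ℤ) (x : ℕ → G) : (∀ c, IsColoringAt n x c) ↔
    (0 < n → IsNegTwist x (fun j => x (2 * k n + 4 - j)) (k n)) ∧
    (¬ 0 < n → IsNegTwist (fun j => x (2 * k n + 4 - j)) x (k n)) ∧
    IsPosTwist (fun j => x (k n + j)) (fun j => x (2 * k n + 8 - j)) 4 := by
  constructor
  · intro H
    refine ⟨fun hn i hi => ?_, fun hn i hi => ?_, fun j hj => ?_⟩
    · exact (isColoringAt_of_pos x (c := ⟨i, by omega⟩) hi hn).1 (H _)
    · exact (isColoringAt_of_not_pos x (c := ⟨i, by omega⟩) hi hn).1 (H _)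
    · exact (isColoringAt_of_le x (c := ⟨k n + j, by omega⟩) rfl).1 (H _)
  · rintro ⟨h1, h2, h3⟩ c
    by_cases hc : (c : ℕ) < k n
    · by_cases hn : 0 < n
      · exact (isColoringAt_of_pos x hc hn).2 (h1 hn c hc)
      · exact (isColoringAt_of_not_pos x hc hn).2 (h2 hn c hc)
    · have := c.2
      exact (isColoringAt_of_le x (j := c - k n) (by omega)).2 (h3 _ (by omega))

/-- The meridians of the edges in terms of those of the edges `0` and `k n`. -/
def edgeWord (n : ℤ) (a c : G) (i : ℕ) : G :=
  if i < k n then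
    if 0 < n then MulAut.conj (twistR a c ^ (i / 2)) a
    else MulAut.conj ((twistR a c)⁻¹ ^ ((i + 1) / 2)) a
  else if i < k n + 4 then MulAut.conj (twistS a c ^ ((i - k n) / 2)) c
  else if i < 2 * k n + 4 then
    if 0 < n then MulAut.conj (twistR a c ^ ((2 * k n + 4 - i + 1) / 2)) (a * twistR a c)
    else MulAut.conj ((twistR a c)⁻¹ ^ ((2 * k n + 4 - i) / 2)) (a * twistR a c)
  else MulAut.conj (twistS a c ^ ((2 * k n + 8 - i + 1) / 2)) a

theorem zpow_eq_of_pos {n : ℤ} (hn : 0 < n) (r : G) : r ^ n = r ^ n.natAbs := by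
  rw [← zpow_natCast, Int.natAbs_of_nonneg hn.le]

theorem zpow_eq_of_not_pos {n : ℤ} (hn : ¬ 0 < n) (r : G) : r ^ n = r⁻¹ ^ n.natAbs := by
  rw [← zpow_natCast, inv_zpow', Int.ofNat_natAbs_of_nonpos (not_lt.1 hn), neg_neg]

theorem conj_zpow_left {n : ℤ} {a c : G} (h : c * twistR a c ^ n = twistR a c ^ n * a) :
    MulAut.conj (twistR a c ^ n) a = c := by
  rw [MulAut.conj_apply, ← h]; group

theorem conj_zpow_right {n : ℤ} {a c : G} (h : c * twistR a c ^ n = twistR a c ^ n * a) :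
    MulAut.conj (twistR a c ^ n) (a * twistR a c) = MulAut.conj (twistS a c ^ 2) c := by
  rw [map_mul, conj_zpow_left h, MulAut.conj_apply (twistS a c ^ 2), ← mul_twistR,
    MulAut.conj_apply, (Commute.zpow_self _ n).eq, mul_inv_cancel_right]

theorem edgeWord_first {n : ℤ} {a c : G} (h : c * twistR a c ^ n = twistR a c ^ n * a) {i : ℕ}
    (hi : i ≤ k n) : edgeWord n a c i = if 0 < n then MulAut.conj (twistR a c ^ (i / 2)) a
      else MulAut.conj ((twistR a c)⁻¹ ^ ((i + 1) / 2)) a := by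
  rcases hi.lt_or_eq with hi | rfl
  · simp only [edgeWord, hi, if_true]
  · have h1 : ¬ k n < k n := lt_irrefl _
    have h2 : k n < k n + 4 := by omega
    simp only [edgeWord, h1, h2, if_true, if_false]
    rw [show (k n - k n) / 2 = 0 by omega, pow_zero, map_one, MulAut.one_apply]
    split_ifs with hn
    · rw [show k n / 2 = n.natAbs by unfold k; omega, ← zpow_eq_of_pos hn, conj_zpow_left h]
    · rw [show (k n + 1) / 2 = n.natAbs by unfold k; omega, ← zpow_eq_of_not_pos hn,
        conj_zpow_left h]

theorem edgeWord_second {n : ℤ} {a c : G} (h : c * twistR a c ^ n = twistR a c ^ n * a) {j : ℕ}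
    (hj : j ≤ 4) : edgeWord n a c (k n + j) = MulAut.conj (twistS a c ^ (j / 2)) c := by
  have h1 : ¬ k n + j < k n := by omega
  rcases hj.lt_or_eq with hj | rfl
  · have h2 : k n + j < k n + 4 := by omega
    simp only [edgeWord, h1, h2, if_true, if_false]
    rw [Nat.add_sub_cancel_left]
  · have h2 : ¬ k n + 4 < k n + 4 := by omega
    simp only [edgeWord, h1, h2, if_false]
    split_ifs with h3 hn
    · rw [show (2 * k n + 4 - (k n + 4) + 1) / 2 = n.natAbs by unfold k; omega,
        ← zpow_eq_of_pos hn, conj_zpow_right h]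
    · rw [show (2 * k n + 4 - (k n + 4)) / 2 = n.natAbs by unfold k; omega,
        ← zpow_eq_of_not_pos hn, conj_zpow_right h]
    -- For `n = 0` the third stretch is empty, and the relation reads `c = a`.
    · have hk : k n = 0 := by omega
      have hn : n = 0 := by unfold k at hk; omega
      subst hn
      have : c = a := by simpa using h
      rw [hk, this]

theorem edgeWord_third (n : ℤ) (a c : G) {j : ℕ}
    (hj : j ≤ k n) : edgeWord n a c (2 * k n + 4 - j) =
      if 0 < n then MulAut.conj (twistR a c ^ ((j + 1) / 2)) (a * twistR a c)
      else MulAut.conj ((twistR a c)⁻¹ ^ (j / 2)) (a * twistR a c) := by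
  have h1 : ¬ 2 * k n + 4 - j < k n := by omega
  have h2 : ¬ 2 * k n + 4 - j < k n + 4 := by omega
  simp only [edgeWord, h1, h2, if_false]
  rcases Nat.eq_zero_or_pos j with rfl | hj0
  · have h3 : ¬ 2 * k n + 4 - 0 < 2 * k n + 4 := by omega
    simp only [h3, if_false]
    rw [show (2 * k n + 8 - (2 * k n + 4 - 0) + 1) / 2 = 2 by omega, MulAut.conj_apply,
      twistS_conj]
    simp
  · have h3 : 2 * k n + 4 - j < 2 * k n + 4 := by omega
    simp only [h3, if_true]
    rw [show 2 * k n + 4 - (2 * k n + 4 - j) = j by omega]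

theorem edgeWord_fourth (n : ℤ) (a c : G) {j : ℕ}
    (hj : j ≤ 4) : edgeWord n a c (2 * k n + 8 - j) =
      MulAut.conj (twistS a c ^ ((j + 1) / 2)) a := by
  have h1 : ¬ 2 * k n + 8 - j < k n := by omega
  have h2 : ¬ 2 * k n + 8 - j < k n + 4 := by omega
  have h3 : ¬ 2 * k n + 8 - j < 2 * k n + 4 := by omega
  simp only [edgeWord, h1, h2, h3, if_false]
  rw [show 2 * k n + 8 - (2 * k n + 8 - j) = j by omega]

theorem edgeWord_isColoring {n : ℤ} {a c : G} (h : c * twistR a c ^ n = twistR a c ^ n * a) :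
    ∀ d, IsColoringAt n (edgeWord n a c) d := by
  rw [isColoring_iff]
  refine ⟨fun hn => ?_, fun hn => ?_, ?_⟩
  · refine isNegTwist_of (x := a) (y := a * twistR a c) rfl fun i hi => ?_
    rw [edgeWord_first h hi, edgeWord_third n a c hi, if_pos hn, if_pos hn]
    exact ⟨rfl, rfl⟩
  · refine isNegTwist_of (x := a * twistR a c) (y := a) (r := (twistR a c)⁻¹) (by group)
      fun i hi => ?_
    rw [edgeWord_first h hi, edgeWord_third n a c hi, if_neg hn, if_neg hn]
    exact ⟨rfl, rfl⟩
  · refine isPosTwist_of (x := c) (y := a) (r := twistS a c) (by simp [twistS]) fun i hi => ?_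
    rw [edgeWord_second h hi, edgeWord_fourth n a c hi]
    exact ⟨rfl, rfl⟩

/-- Every coloring is determined by the meridians of the edges `0` and `k n`, which satisfy the
relation. -/
theorem relation_of_isColoring {n : ℤ} {x : ℕ → G} (hx : x (2 * k n + 8) = x 0)
    (H : ∀ d, IsColoringAt n x d) :
    x (k n) * twistR (x 0) (x (k n)) ^ n = twistR (x 0) (x (k n)) ^ n * x 0 ∧
      ∀ i ≤ 2 * k n + 8, x i = edgeWord n (x 0) (x (k n)) i := by
  rw [isColoring_iff] at H
  obtain ⟨H1, H2, H3⟩ := H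
  set a := x 0 with ha
  set c := x (k n) with hc
  have E3 := H3.eq (r := twistS a c) (by simp only [twistS, hx, add_zero, tsub_zero, inv_mul_cancel_right]; exact hc)
  simp only [add_zero, tsub_zero, hx, ← hc] at E3
  have hb : x (2 * k n + 4) = a * twistR a c := by
    have := (E3 4 le_rfl).2
    rw [show 2 * k n + 8 - 4 = 2 * k n + 4 by omega] at this
    rw [this, ← twistS_conj]; rfl
  have E1 : ∀ i ≤ k n, x i = (if 0 < n then MulAut.conj (twistR a c ^ (i / 2)) a
      else MulAut.conj ((twistR a c)⁻¹ ^ ((i + 1) / 2)) a) ∧ x (2 * k n + 4 - i) =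
      if 0 < n then MulAut.conj (twistR a c ^ ((i + 1) / 2)) (a * twistR a c)
      else MulAut.conj ((twistR a c)⁻¹ ^ (i / 2)) (a * twistR a c) := by
    intro i hi
    split_ifs with hn
    · have := (H1 hn).eq (r := twistR a c) (by simp [hb, ← ha]) i hi
      simpa [hb, ← ha] using this
    · have := (H2 hn).eq (r := (twistR a c)⁻¹) (by simp [hb, ← ha]) i hi
      simpa [hb, ← ha] using this.symm
  -- Transport through the first region ends at the edge `k n`, whose meridian is `c`: this is the
  -- one relation left.
  have hrel : c * twistR a c ^ n = twistR a c ^ n * a := by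
    have h1 := (E1 (k n) le_rfl).1
    rw [← hc] at h1
    split_ifs at h1 with hn
    · rw [show k n / 2 = n.natAbs by unfold k; omega, ← zpow_eq_of_pos hn, MulAut.conj_apply] at h1
      nth_rewrite 1 [h1]; group
    · rw [show (k n + 1) / 2 = n.natAbs by unfold k; omega, ← zpow_eq_of_not_pos hn,
        MulAut.conj_apply] at h1
      nth_rewrite 1 [h1]; group
  refine ⟨hrel, fun i hi => ?_⟩
  by_cases h1 : i ≤ k n
  · rw [edgeWord_first hrel h1, (E1 i h1).1]
  by_cases h2 : i ≤ k n + 4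
  · obtain ⟨j, rfl⟩ : ∃ j, i = k n + j := ⟨i - k n, by omega⟩
    rw [edgeWord_second hrel (by omega), (E3 j (by omega)).1]
  by_cases h3 : i ≤ 2 * k n + 4
  · obtain ⟨j, hj, rfl⟩ : ∃ j ≤ k n, i = 2 * k n + 4 - j := ⟨2 * k n + 4 - i, by omega, by omega⟩
    rw [edgeWord_third n a c hj, (E1 j hj).2]
  · obtain ⟨j, hj, rfl⟩ : ∃ j ≤ 4, i = 2 * k n + 8 - j := ⟨2 * k n + 8 - i, by omega, by omega⟩
    rw [edgeWord_fourth n a c hj, (E3 j hj).2]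

end ConwayKnot

/-! ### From colorings to the knot group and its longitude -/

theorem SignedGaussCode.passFactor_overAt (D : SignedGaussCode) (d : Fin D.crossings) :
    D.passFactor (D.overAt d) = 1 := by
  have : (Equiv.ofBijective _ D.passes).symm (D.overAt d) = Sum.inl d := by
    rw [Equiv.symm_apply_eq]; rfl
  unfold SignedGaussCode.passFactor
  rw [this]

theorem SignedGaussCode.passFactor_underAt (D : SignedGaussCode) (d : Fin D.crossings) :
    D.passFactor (D.underAt d) = D.edgeMeridian (D.overAt d) ^ (D.sign d : ℤ) := by
  have : (Equiv.ofBijective _ D.passes).symm (D.underAt d) = Sum.inr d := by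
    rw [Equiv.symm_apply_eq]; rfl
  unfold SignedGaussCode.passFactor
  rw [this]

namespace ConwayKnot

variable {G : Type*} [Group G]

theorem natCast_val_edge {α : Type*} (n : ℤ) (x : ℕ → α) (hx : x (2 * k n + 8) = x 0) {i : ℕ}
    (hi : i ≤ 2 * k n + 8) : x ((i : ZMod (2 * (k n + 4))).val) = x i := by
  rw [ZMod.val_natCast]
  rcases hi.lt_or_eq with h | rfl
  · rw [Nat.mod_eq_of_lt (by omega)]
  · rw [hx, show 2 * (k n + 4) = 2 * k n + 8 by ring, Nat.mod_self]

theorem overPass_lt (n : ℤ) (c : Fin (k n + 4)) : overPass n c < 2 * k n + 8 := by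
  have := c.2
  unfold overPass firstPass secondPass; split_ifs <;> omega

theorem underPass_lt (n : ℤ) (c : Fin (k n + 4)) : underPass n c < 2 * k n + 8 := by
  have := c.2
  unfold underPass firstPass secondPass; split_ifs <;> omega

/-- A coloring gives a homomorphism of the knot group. -/
theorem exists_hom (n : ℤ) {a c : G} (h : c * twistR a c ^ n = twistR a c ^ n * a) :
    ∃ ρ : (knot n).knotGroup →* G, ρ (knot n).meridian = a ∧ ρ ((knot n).edgeMeridian (k n : ℕ)) = c := by
  -- The coloring closes up, so it descends to the cyclic index set of the edges.
  have hx : edgeWord n a c (2 * k n + 8) = edgeWord n a c 0 := by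
    have h1 := edgeWord_fourth n a c (Nat.zero_le 4)
    have h2 := edgeWord_first h (Nat.zero_le _)
    rw [show 2 * k n + 8 - 0 = 2 * k n + 8 by omega] at h1
    rw [h1, h2]
    simp
  have hcol := edgeWord_isColoring h
  have hv : ∀ {i : ℕ}, i ≤ 2 * k n + 8 →
      edgeWord n a c ((i : ZMod (2 * (k n + 4))).val) = edgeWord n a c i :=
    natCast_val_edge n _ hx
  let f : ZMod (2 * (knot n).crossings) → G :=
    fun z => edgeWord n a c (ZMod.val (n := 2 * (k n + 4)) z)
  have hf : ∀ i ≤ 2 * k n + 8, f (i : ℕ) = edgeWord n a c i := fun i hi => hv hi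
  have hover : ∀ d, (knot n).overAt d = (overPass n d : ℕ) := fun d => rfl
  have hunder : ∀ d, (knot n).underAt d = (underPass n d : ℕ) := fun d => rfl
  have hrels : ∀ r ∈ (knot n).wirtingerRels, FreeGroup.lift f r = 1 := by
    rintro r ⟨d, hr | hr⟩
    · have := (hcol d).1
      rw [hr, hover, ← Nat.cast_add_one]
      simp only [map_mul, map_inv, FreeGroup.lift_apply_of]
      rw [hf _ (overPass_lt n d), hf _ (overPass_lt n d).le, this]
      group
    · have := (hcol d).2
      rw [hr, hover, hunder, ← Nat.cast_add_one]
      simp only [map_mul, map_inv, map_zpow, FreeGroup.lift_apply_of]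
      rw [hf _ (underPass_lt n d), hf _ (overPass_lt n d).le, hf _ (underPass_lt n d).le, this]
      exact inv_mul_cancel _
  refine ⟨PresentedGroup.toGroup hrels, ?_, ?_⟩
  · show PresentedGroup.toGroup hrels (PresentedGroup.of _) = a
    rw [PresentedGroup.toGroup.of, ← Nat.cast_zero, hf _ (Nat.zero_le _),
      edgeWord_first h (Nat.zero_le _)]
    simp
  · show PresentedGroup.toGroup hrels (PresentedGroup.of _) = c
    rw [PresentedGroup.toGroup.of, hf _ (by omega)]
    have := edgeWord_second h (Nat.zero_le 4)
    simpa using this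

/-- The meridians of the edges, indexed by natural numbers. -/
def edge (n : ℤ) (i : ℕ) : (knot n).knotGroup := (knot n).edgeMeridian (i : ZMod (2 * (k n + 4)))

theorem edge_isColoring (n : ℤ) : ∀ d, IsColoringAt n (edge n) d := by
  intro d
  have hover : (knot n).overAt d = (overPass n d : ℕ) := rfl
  have hunder : (knot n).underAt d = (underPass n d : ℕ) := rfl
  constructor
  · have := PresentedGroup.one_of_mem (rels := (knot n).wirtingerRels) ⟨d, Or.inl rfl⟩
    rw [hover, ← Nat.cast_add_one, map_mul, map_inv, inv_mul_eq_one] at this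
    exact this
  · have := PresentedGroup.one_of_mem (rels := (knot n).wirtingerRels) ⟨d, Or.inr rfl⟩
    rw [hover, hunder, ← Nat.cast_add_one, map_mul, map_inv, inv_mul_eq_one, map_mul, map_mul,
      map_zpow, map_zpow] at this
    exact this

theorem edge_last (n : ℤ) : edge n (2 * k n + 8) = edge n 0 := by
  unfold edge
  rw [show 2 * k n + 8 = 2 * (k n + 4) by ring, ZMod.natCast_self, Nat.cast_zero]

theorem edge_relation (n : ℤ) : edge n (k n) * twistR (edge n 0) (edge n (k n)) ^ n =
    twistR (edge n 0) (edge n (k n)) ^ n * edge n 0 :=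
  (relation_of_isColoring (edge_last n) (edge_isColoring n)).1

theorem edge_eq_edgeWord (n : ℤ) {i : ℕ} (hi : i ≤ 2 * k n + 8) :
    edge n i = edgeWord n (edge n 0) (edge n (k n)) i :=
  (relation_of_isColoring (edge_last n) (edge_isColoring n)).2 i hi

theorem meridian_eq (n : ℤ) : (knot n).meridian = edge n 0 := by
  simp only [SignedGaussCode.meridian, edge, Nat.cast_zero]; rfl

theorem closure_edges (n : ℤ) : Subgroup.closure {edge n 0, edge n (k n)} = ⊤ := by
  set H := Subgroup.closure {edge n 0, edge n (k n)} with hH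
  have ha : edge n 0 ∈ H := Subgroup.subset_closure (by simp)
  have hc : edge n (k n) ∈ H := Subgroup.subset_closure (by simp)
  have hs : twistS (edge n 0) (edge n (k n)) ∈ H := H.mul_mem hc (H.inv_mem ha)
  have hr : twistR (edge n 0) (edge n (k n)) ∈ H :=
    H.mul_mem (H.mul_mem (H.mul_mem (H.inv_mem ha) (H.pow_mem hs 2)) ha)
      (H.inv_mem (H.pow_mem hs 2))
  have hconj : ∀ {g x}, g ∈ H → x ∈ H → MulAut.conj g x ∈ H := fun hg hx =>
    H.mul_mem (H.mul_mem hg hx) (H.inv_mem hg)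
  rw [eq_top_iff, ← PresentedGroup.closure_range_of, Subgroup.closure_le]
  rintro _ ⟨z, rfl⟩
  have hz : (PresentedGroup.of z : (knot n).knotGroup) = edge n (ZMod.val (n := 2 * (k n + 4)) z) :=
    congrArg PresentedGroup.of (ZMod.natCast_zmod_val (n := 2 * (k n + 4)) z).symm
  have hlt : ZMod.val (n := 2 * (k n + 4)) z < 2 * (k n + 4) := ZMod.val_lt _
  rw [hz, edge_eq_edgeWord n (by omega)]
  unfold edgeWord
  split_ifs
  · exact hconj (H.pow_mem hr _) ha
  · exact hconj (H.pow_mem (H.inv_mem hr) _) ha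
  · exact hconj (H.pow_mem hs _) hc
  · exact hconj (H.pow_mem hr _) (H.mul_mem ha hr)
  · exact hconj (H.pow_mem (H.inv_mem hr) _) (H.mul_mem ha hr)
  · exact hconj (H.pow_mem hs _) ha

theorem writhe_eq (n : ℤ) : (knot n).writhe = 4 - 2 * n := by
  have : (knot n).writhe = ∑ i : Fin (k n + 4), (if (i : ℕ) < k n ∧ 0 < n then (-1 : ℤ) else 1) := by
    unfold SignedGaussCode.writhe
    refine Finset.sum_congr rfl fun d _ => ?_
    by_cases h : (d : ℕ) < k n ∧ 0 < n
    · rw [if_pos h]; exact sign_neg h.1 h.2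
    · rw [if_neg h]; exact sign_pos h
  rw [this, Fin.sum_univ_add]
  have hk : (k n : ℤ) = 2 * |n| := by unfold k; push_cast; simp
  by_cases hn : 0 < n
  · simp [hn, hk, abs_of_pos hn]; ring
  · simp [hn, hk, abs_of_nonpos (not_lt.1 hn)]; ring

/-- The contributions of the passes to the longitude, indexed by natural numbers. -/
def factor (n : ℤ) (i : ℕ) : (knot n).knotGroup := (knot n).passFactor (i : ZMod (2 * (k n + 4)))

theorem factor_overPass (n : ℤ) (d : Fin (k n + 4)) : factor n (overPass n d) = 1 :=
  (knot n).passFactor_overAt d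

theorem factor_underPass (n : ℤ) (d : Fin (k n + 4)) :
    factor n (underPass n d) = edge n (overPass n d) ^ ((knot n).sign d : ℤ) :=
  (knot n).passFactor_underAt d

theorem factor_of_pos_even {n : ℤ} (hn : 0 < n) {i : ℕ} (hi : i < k n) (he : Even i) :
    factor n i = 1 ∧ factor n (2 * k n + 4 - (i + 1)) = (edge n i)⁻¹ := by
  let c : Fin (k n + 4) := ⟨i, by omega⟩
  have hc : (c : ℕ) < k n := hi
  obtain ⟨h3, h4⟩ := overPass_of ((firstIsOver_of_pos hc hn).2 he)
  have h5 := factor_overPass n c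
  have h6 := factor_underPass n c
  rw [h4, (secondPass_of_lt hc).1, h3, sign_neg hc hn, zpow_neg_one] at h6
  rw [h3] at h5
  exact ⟨h5, h6⟩

theorem factor_of_pos_odd {n : ℤ} (hn : 0 < n) {i : ℕ} (hi : i < k n) (he : ¬ Even i) :
    factor n i = (edge n (2 * k n + 4 - (i + 1)))⁻¹ ∧ factor n (2 * k n + 4 - (i + 1)) = 1 := by
  let c : Fin (k n + 4) := ⟨i, by omega⟩
  have hc : (c : ℕ) < k n := hi
  obtain ⟨h3, h4⟩ := overPass_of_not (mt (firstIsOver_of_pos hc hn).1 he)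
  have h5 := factor_overPass n c
  have h6 := factor_underPass n c
  rw [h4, h3, (secondPass_of_lt hc).1, sign_neg hc hn, zpow_neg_one] at h6
  rw [h3, (secondPass_of_lt hc).1] at h5
  exact ⟨h6, h5⟩

theorem factor_of_not_pos_even {n : ℤ} (hn : ¬ 0 < n) {i : ℕ} (hi : i < k n) (he : Even i) :
    factor n i = edge n (2 * k n + 4 - (i + 1)) ∧ factor n (2 * k n + 4 - (i + 1)) = 1 := by
  let c : Fin (k n + 4) := ⟨i, by omega⟩
  have hc : (c : ℕ) < k n := hi
  obtain ⟨h3, h4⟩ := overPass_of_not (mt (firstIsOver_of_not_pos hc hn).1 (not_not.2 he))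
  have h5 := factor_overPass n c
  have h6 := factor_underPass n c
  rw [h4, h3, (secondPass_of_lt hc).1, sign_pos (by tauto), zpow_one] at h6
  rw [h3, (secondPass_of_lt hc).1] at h5
  exact ⟨h6, h5⟩

theorem factor_of_not_pos_odd {n : ℤ} (hn : ¬ 0 < n) {i : ℕ} (hi : i < k n) (he : ¬ Even i) :
    factor n i = 1 ∧ factor n (2 * k n + 4 - (i + 1)) = edge n i := by
  let c : Fin (k n + 4) := ⟨i, by omega⟩
  have hc : (c : ℕ) < k n := hi
  obtain ⟨h3, h4⟩ := overPass_of ((firstIsOver_of_not_pos hc hn).2 he)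
  have h5 := factor_overPass n c
  have h6 := factor_underPass n c
  rw [h4, (secondPass_of_lt hc).1, h3, sign_pos (by tauto), zpow_one] at h6
  rw [h3] at h5
  exact ⟨h5, h6⟩

theorem factor_of_le_even (n : ℤ) {j : ℕ} (hj : j < 4) (he : Even j) :
    factor n (k n + j) = 1 ∧ factor n (2 * k n + 8 - (j + 1)) = edge n (k n + j) := by
  let c : Fin (k n + 4) := ⟨k n + j, by omega⟩
  have hc : ¬ (c : ℕ) < k n := by simp [c]
  obtain ⟨h3, h4⟩ := overPass_of ((firstIsOver_of_le hc).2 ((even_k n).add he))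
  have h5 := factor_overPass n c
  have h6 := factor_underPass n c
  rw [h4, (secondPass_of_le (c := c) rfl).1, h3, sign_pos (by tauto), zpow_one] at h6
  rw [h3] at h5
  exact ⟨h5, h6⟩

theorem factor_of_le_odd (n : ℤ) {j : ℕ} (hj : j < 4) (he : ¬ Even j) :
    factor n (k n + j) = edge n (2 * k n + 8 - (j + 1)) ∧
      factor n (2 * k n + 8 - (j + 1)) = 1 := by
  let c : Fin (k n + 4) := ⟨k n + j, by omega⟩
  have hc : ¬ (c : ℕ) < k n := by simp [c]
  have he' : ¬ Even (c : ℕ) := by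
    show ¬ Even (k n + j)
    rw [Nat.even_add]; simp [even_k, he]
  obtain ⟨h3, h4⟩ := overPass_of_not (mt (firstIsOver_of_le hc).1 he')
  have h5 := factor_overPass n c
  have h6 := factor_underPass n c
  rw [h4, h3, (secondPass_of_le (c := c) rfl).1, sign_pos (by tauto), zpow_one] at h6
  rw [h3, (secondPass_of_le (c := c) rfl).1] at h5
  exact ⟨h6, h5⟩

/-- The initial pieces of the blackboard longitude. -/
def partialLongitude (n : ℤ) (m : ℕ) : (knot n).knotGroup := ((List.range m).map (factor n)).prod

theorem partialLongitude_succ (n : ℤ) (m : ℕ) :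
    partialLongitude n (m + 1) = partialLongitude n m * factor n m := by
  simp [partialLongitude, List.range_succ]

/-- A telescoping product: each pair of passes adds one `a⁻¹` on the left and one `R⁻¹` on the right
for `n > 0`, and the inverses of these otherwise. -/
theorem partialLongitude_first (n : ℤ) : partialLongitude n (k n) =
    (edge n 0 ^ n)⁻¹ * (twistR (edge n 0) (edge n (k n)) ^ n)⁻¹ := by
  have hrel := edge_relation n
  set a := edge n 0 with ha
  set c := edge n (k n) with hc
  set r := twistR a c with hr
  by_cases hn : 0 < n
  · have H : ∀ j ≤ n.natAbs, partialLongitude n (2 * j) = (a ^ j)⁻¹ * (r ^ j)⁻¹ := by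
      intro j
      induction j with
      | zero => simp [partialLongitude]
      | succ j ih =>
        intro hj
        have hlt : 2 * j + 1 < k n := by unfold k; omega
        rw [show 2 * (j + 1) = 2 * j + 1 + 1 by ring, partialLongitude_succ, partialLongitude_succ,
          ih (by omega), (factor_of_pos_even hn (by omega) ⟨j, by ring⟩).1,
          (factor_of_pos_odd hn hlt (by simp)).1,
          edge_eq_edgeWord n (by omega), edgeWord_third n _ _ (by omega), if_pos hn,
          show (2 * j + 1 + 1 + 1) / 2 = j + 1 by omega, MulAut.conj_apply]
        simp only [← ha, ← hc, ← hr, pow_succ]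
        group
    rw [show k n = 2 * n.natAbs from rfl, H _ le_rfl, zpow_eq_of_pos hn, zpow_eq_of_pos hn]
  · have H : ∀ j ≤ n.natAbs, partialLongitude n (2 * j) = a ^ j * (r⁻¹ ^ j)⁻¹ := by
      intro j
      induction j with
      | zero => simp [partialLongitude]
      | succ j ih =>
        intro hj
        have hlt : 2 * j + 1 < k n := by unfold k; omega
        rw [show 2 * (j + 1) = 2 * j + 1 + 1 by ring, partialLongitude_succ, partialLongitude_succ,
          ih (by omega), (factor_of_not_pos_even hn (by omega) ⟨j, by ring⟩).1,
          (factor_of_not_pos_odd hn hlt (by simp)).1,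
          edge_eq_edgeWord n (by omega), edgeWord_third n _ _ (by omega), if_neg hn,
          show (2 * j + 1) / 2 = j by omega, MulAut.conj_apply]
        simp only [← ha, ← hc, ← hr, pow_succ]
        group
    rw [show k n = 2 * n.natAbs from rfl, H _ le_rfl, zpow_eq_of_not_pos hn, zpow_eq_of_not_pos hn]
    simp

theorem partialLongitude_second (n : ℤ) : partialLongitude n (k n + 4) = partialLongitude n (k n) *
    (edge n (k n) ^ 2 * (twistS (edge n 0) (edge n (k n)) ^ 2)⁻¹) := by
  have e0 := (factor_of_le_even n (j := 0) (by omega) (by decide)).1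
  have e1 := (factor_of_le_odd n (j := 1) (by omega) (by decide)).1
  have e2 := (factor_of_le_even n (j := 2) (by omega) (by decide)).1
  have e3 := (factor_of_le_odd n (j := 3) (by omega) (by decide)).1
  rw [edge_eq_edgeWord n (by omega), edgeWord_fourth n _ _ (by omega), MulAut.conj_apply] at e1 e3
  have hs : edge n (k n) = twistS (edge n 0) (edge n (k n)) * edge n 0 := by simp [twistS]
  rw [add_zero] at e0
  rw [show k n + 4 = k n + 3 + 1 from rfl, partialLongitude_succ, show k n + 3 = k n + 2 + 1 from rfl,
    partialLongitude_succ, show k n + 2 = k n + 1 + 1 from rfl, partialLongitude_succ,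
    partialLongitude_succ, e0, e1, e2, e3, mul_assoc, mul_assoc, mul_assoc]
  congr 1
  generalize twistS (edge n 0) (edge n (k n)) = s at hs ⊢
  rw [hs]
  norm_num [pow_succ]
  group

theorem partialLongitude_third (n : ℤ) : partialLongitude n (2 * k n + 4) =
    partialLongitude n (k n + 4) * (twistR (edge n 0) (edge n (k n)) ^ n *
      ((edge n 0 * twistR (edge n 0) (edge n (k n))) ^ n)⁻¹) := by
  have hrel := edge_relation n
  set a := edge n 0 with ha
  set c := edge n (k n) with hc
  set r := twistR a c with hr
  have hk : k n = 2 * n.natAbs := rfl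
  by_cases hn : 0 < n
  · have H : ∀ j ≤ n.natAbs, partialLongitude n (k n + 4 + 2 * j) = partialLongitude n (k n + 4) *
        (r ^ n.natAbs * ((a * r) ^ j)⁻¹ * (r ^ (n.natAbs - j))⁻¹) := by
      intro j
      induction j with
      | zero => simp
      | succ j ih =>
        intro hj
        -- The region is now run backwards: `l` counts the pairs of crossings that remain.
        obtain ⟨l, hl⟩ : ∃ l, n.natAbs = j + 1 + l := ⟨n.natAbs - (j + 1), by omega⟩
        have f0 := (factor_of_pos_odd hn (i := 2 * l + 1) (by omega) (by simp)).2
        have f1 := (factor_of_pos_even hn (i := 2 * l) (by omega) ⟨l, by ring⟩).2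
        rw [edge_eq_edgeWord n (by omega), edgeWord_first hrel (by omega), if_pos hn,
          show 2 * l / 2 = l by omega, MulAut.conj_apply, ← hr] at f1
        rw [show 2 * k n + 4 - (2 * l + 1 + 1) = k n + 4 + 2 * j by omega] at f0
        rw [show 2 * k n + 4 - (2 * l + 1) = k n + 4 + 2 * j + 1 by omega] at f1
        rw [show k n + 4 + 2 * (j + 1) = k n + 4 + 2 * j + 1 + 1 by ring, partialLongitude_succ,
          partialLongitude_succ, ih (by omega), f0, f1, show n.natAbs - j = l + 1 by omega,
          show n.natAbs - (j + 1) = l by omega, pow_succ' (a * r) j, pow_succ r l,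
          mul_inv_rev (a * r), mul_inv_rev a r]
        generalize ((a * r) ^ j)⁻¹ = B
        group
    rw [show 2 * k n + 4 = k n + 4 + 2 * n.natAbs by omega, H _ le_rfl, zpow_eq_of_pos hn,
      zpow_eq_of_pos hn, Nat.sub_self]
    simp
  · have H : ∀ j ≤ n.natAbs, partialLongitude n (k n + 4 + 2 * j) = partialLongitude n (k n + 4) *
        (r⁻¹ ^ n.natAbs * (a * r) ^ j * (r⁻¹ ^ (n.natAbs - j))⁻¹) := by
      intro j
      induction j with
      | zero => simp
      | succ j ih =>
        intro hj
        obtain ⟨l, hl⟩ : ∃ l, n.natAbs = j + 1 + l := ⟨n.natAbs - (j + 1), by omega⟩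
        have f0 := (factor_of_not_pos_odd hn (i := 2 * l + 1) (by omega) (by simp)).2
        have f1 := (factor_of_not_pos_even hn (i := 2 * l) (by omega) ⟨l, by ring⟩).2
        rw [edge_eq_edgeWord n (by omega), edgeWord_first hrel (by omega), if_neg hn,
          show (2 * l + 1 + 1) / 2 = l + 1 by omega, MulAut.conj_apply] at f0
        rw [show 2 * k n + 4 - (2 * l + 1 + 1) = k n + 4 + 2 * j by omega] at f0
        rw [show 2 * k n + 4 - (2 * l + 1) = k n + 4 + 2 * j + 1 by omega] at f1
        rw [show k n + 4 + 2 * (j + 1) = k n + 4 + 2 * j + 1 + 1 by ring, partialLongitude_succ,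
          partialLongitude_succ, ih (by omega), f0, f1, show n.natAbs - j = l + 1 by omega,
          show n.natAbs - (j + 1) = l by omega, pow_succ (a * r) j, pow_succ' r⁻¹ l]
        group
    rw [show 2 * k n + 4 = k n + 4 + 2 * n.natAbs by omega, H _ le_rfl, zpow_eq_of_not_pos hn,
      zpow_eq_of_not_pos hn, Nat.sub_self, inv_pow (a * r), inv_inv]
    simp

theorem partialLongitude_fourth (n : ℤ) : partialLongitude n (2 * k n + 8) =
    partialLongitude n (2 * k n + 4) * (twistS (edge n 0) (edge n (k n)) ^ 2 * edge n 0 ^ 2) := by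
  have hrel := edge_relation n
  have e0 := (factor_of_le_even n (j := 0) (by omega) (by decide)).2
  have e1 := (factor_of_le_odd n (j := 1) (by omega) (by decide)).2
  have e2 := (factor_of_le_even n (j := 2) (by omega) (by decide)).2
  have e3 := (factor_of_le_odd n (j := 3) (by omega) (by decide)).2
  rw [edge_eq_edgeWord n (by omega), edgeWord_second hrel (by omega), MulAut.conj_apply] at e0 e2
  have hs : edge n 0 = (twistS (edge n 0) (edge n (k n)))⁻¹ * edge n (k n) := by simp [twistS]
  rw [show 2 * k n + 8 = 2 * k n + 4 + 1 + 1 + 1 + 1 by ring, partialLongitude_succ,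
    partialLongitude_succ, partialLongitude_succ, partialLongitude_succ]
  rw [show 2 * k n + 8 - (3 + 1) = 2 * k n + 4 by omega] at e3
  rw [show 2 * k n + 8 - (2 + 1) = 2 * k n + 4 + 1 by omega] at e2
  rw [show 2 * k n + 8 - (1 + 1) = 2 * k n + 4 + 1 + 1 by omega] at e1
  rw [show 2 * k n + 8 - (0 + 1) = 2 * k n + 4 + 1 + 1 + 1 by omega] at e0
  rw [e0, e1, e2, e3, mul_assoc, mul_assoc, mul_assoc]
  congr 1
  generalize twistS (edge n 0) (edge n (k n)) = s at hs ⊢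
  rw [hs]
  norm_num [pow_succ]
  group

theorem longitude_eq (n : ℤ) :
    (knot n).longitude = pairLongitude n (edge n 0) (edge n (k n)) := by
  have h : (knot n).longitude =
      partialLongitude n (2 * (k n + 4)) * (knot n).meridian ^ (-(knot n).writhe) := rfl
  have hrel := edge_relation n
  rw [h, meridian_eq, writhe_eq, show 2 * (k n + 4) = 2 * k n + 8 by ring, partialLongitude_fourth,
    partialLongitude_third, partialLongitude_second, partialLongitude_first]
  have hcomm := pairLongitude_commute hrel
  have hconj := twistS_conj (edge n 0) (edge n (k n))
  have hdef : pairLongitude n (edge n 0) (edge n (k n)) =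
      (twistR (edge n 0) (edge n (k n)) ^ n)⁻¹ * (twistS (edge n 0) (edge n (k n)) ^ 2)⁻¹ *
        twistR (edge n 0) (edge n (k n)) ^ n * twistS (edge n 0) (edge n (k n)) ^ 2 := rfl
  generalize pairLongitude n (edge n 0) (edge n (k n)) = Λ at *
  generalize twistR (edge n 0) (edge n (k n)) = r at *
  generalize twistS (edge n 0) (edge n (k n)) ^ 2 = s at *
  generalize edge n 0 = a at *
  generalize edge n (k n) = c at *
  have hc : c = r ^ n * a * (r ^ n)⁻¹ := by rw [← hrel]; group
  -- The relation and the conjugation by `S ^ 2` turn the powers of `c` and `a * R` into powers of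
  -- `a`. The blackboard longitude with its writhe correction becomes a conjugate of `Λ` by a power
  -- of `a`, with which `Λ` commutes.
  have hc2 : (r ^ n)⁻¹ * c ^ 2 = a ^ 2 * (r ^ n)⁻¹ := by rw [hc, conj_pow]; group
  have hb : ((a * r) ^ n)⁻¹ * s = s * (a ^ n)⁻¹ := by
    rw [← hconj, conj_zpow]; group
  have hΛ : Commute Λ a := hcomm
  calc _ = (a ^ n)⁻¹ * ((r ^ n)⁻¹ * c ^ 2) * s⁻¹ * r ^ n * (((a * r) ^ n)⁻¹ * s) * a ^ 2 *
        a ^ (-(4 - 2 * n)) := by group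
    _ = (a ^ n)⁻¹ * a ^ 2 * ((r ^ n)⁻¹ * s⁻¹ * r ^ n * s) * (a ^ n)⁻¹ * a ^ 2 *
        a ^ (-(4 - 2 * n)) := by rw [hc2, hb]; group
    _ = a ^ (2 - n) * Λ * a ^ (n - 2) := by rw [hdef]; group
    _ = Λ * a ^ (2 - n) * a ^ (n - 2) := by rw [(hΛ.zpow_right (2 - n)).eq]
    _ = Λ := by group

end ConwayKnot

/-! ### The eigenvalue pairs of `C(2n, 4)` -/

namespace ConwayKnot

open Riley

theorem mul_comm_of_edges_eq {G : Type*} [Group G] {n : ℤ} (ρ : (knot n).knotGroup →* G)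
    (h : ρ (edge n (k n)) = ρ (edge n 0)) (g₁ g₂ : (knot n).knotGroup) :
    ρ g₁ * ρ g₂ = ρ g₂ * ρ g₁ := by
  have htop : (Subgroup.zpowers (ρ (edge n 0))).comap ρ = ⊤ := by
    rw [eq_top_iff, ← closure_edges n, Subgroup.closure_le]
    rintro _ (rfl | rfl)
    · exact Subgroup.mem_zpowers (ρ (edge n 0))
    · show ρ (edge n (k n)) ∈ Subgroup.zpowers (ρ (edge n 0))
      rw [h]; exact Subgroup.mem_zpowers _
  have mem : ∀ g, ρ g ∈ Subgroup.zpowers (ρ (edge n 0)) := fun g => by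
    have : g ∈ (Subgroup.zpowers (ρ (edge n 0))).comap ρ := htop ▸ Subgroup.mem_top g
    exact this
  obtain ⟨i, hi⟩ := mem g₁
  obtain ⟨j, hj⟩ := mem g₂
  rw [← hi, ← hj]
  exact (Commute.refl _).zpow_zpow i j

theorem aeval_of_mem_nonabelian {n : ℤ} {v : Fin 2 → ℂ}
    (hv : v ∈ (knot n).nonabelianEigenvaluePairs) :
    aeval v (curvePoly n) = 0 ∨ v 1 ^ 2 - 1 = 0 ∧ v 0 ^ 2 - 1 = 0 := by
  obtain ⟨ρ, ⟨g₁, g₂, hne⟩, h1, h2, h3, h4⟩ := hv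
  rw [longitude_eq, map_pairLongitude] at h1 h3
  rw [meridian_eq] at h2 h4
  have hac : ρ (edge n (k n)) ≠ ρ (edge n 0) := fun h =>
    hne (mul_comm_of_edges_eq ρ h g₁ g₂)
  have hrel := congrArg ρ (edge_relation n)
  rw [map_mul, map_mul, map_zpow, map_twistR] at hrel
  by_cases hM : v 1 ^ 2 - 1 = 0
  · refine Or.inr ⟨hM, ?_⟩
    rw [← h4] at hM
    rw [← h3]
    exact parabolic_longitude hrel hac h2 hM h1
  · left
    rw [aeval_curvePoly]
    rw [← h4] at hM ⊢
    rw [← h3]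
    exact eliminant_of_relation hrel hac h2 hM h1

/-- With `L * M ^ 2 + 1 ≠ 0` the quadratic has two roots over `ℂ`; a zero of the product is a common
zero with the Riley polynomial, from which a pair of matrices is built. -/
theorem mem_nonabelian_of_aeval {n : ℤ} {v : Fin 2 → ℂ} (hA : aeval v (curvePoly n) = 0)
    (hM : v 1 ≠ 0) (hM1 : v 1 ^ 2 - 1 ≠ 0) (hM2 : v 1 ^ 2 + 1 ≠ 0) (hQ : v 0 * v 1 ^ 2 + 1 ≠ 0) :
    v ∈ (knot n).nonabelianEigenvaluePairs := by
  rw [aeval_curvePoly] at hA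
  obtain ⟨L, hL⟩ : ∃ L, L = v 0 := ⟨_, rfl⟩
  obtain ⟨M, hMv⟩ : ∃ M, M = v 1 := ⟨_, rfl⟩
  rw [← hL, ← hMv] at hA hQ
  rw [← hMv] at hM hM1 hM2
  obtain ⟨w, hw⟩ := IsAlgClosed.exists_pow_nat_eq
    (((L + 1) * (M ^ 2 + 1)) ^ 2 + 4 * (L * M ^ 2 + 1) * ((L - 1) * (M ^ 2 - 1))) (n := 2) (by norm_num)
  have key : ∃ y, (L * M ^ 2 + 1) * y ^ 2 - (L + 1) * (M ^ 2 + 1) * y - (L - 1) * (M ^ 2 - 1) = 0 ∧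
      riley n (M ^ 2) y = 0 := by
    set Q := L * M ^ 2 + 1
    set b := (L + 1) * (M ^ 2 + 1)
    set d := (L - 1) * (M ^ 2 - 1)
    have hroot : ∀ w' : ℂ, w' ^ 2 = b ^ 2 + 4 * Q * d →
        Q * ((b + w') / (2 * Q)) ^ 2 - b * ((b + w') / (2 * Q)) - d = 0 := by
      intro w' hw'
      field_simp
      linear_combination hw'
    have hprod := eliminant_eq_mul n (L := L) (m := M ^ 2) (y₁ := (b + w) / (2 * Q))
      (y₂ := (b + -w) / (2 * Q)) (by show Q * _ = b; field_simp; ring)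
      (by show Q * _ = -d; field_simp; linear_combination -hw)
    rw [hA] at hprod
    rcases mul_eq_zero.1 hprod.symm with h | h
    · exact absurd h (pow_ne_zero _ hQ)
    · rcases mul_eq_zero.1 h with h | h
      · exact ⟨_, hroot w hw, h⟩
      · exact ⟨_, hroot (-w) (by rw [neg_sq, hw]), h⟩
  obtain ⟨y, hy, hr⟩ := key
  obtain ⟨a, c, hrel, hne, ha, haM, hl, hlL⟩ := exists_matrixPair hM hM1 hM2 hy hr
  obtain ⟨ρ, hρa, hρc⟩ := exists_hom n hrel
  have hρa' : ρ (edge n 0) = a := by rw [← meridian_eq, hρa]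
  have hρc' : ρ (edge n (k n)) = c := hρc
  refine ⟨ρ, ⟨edge n 0, edge n (k n), by rw [hρa', hρc']; exact hne⟩, ?_⟩
  unfold SignedGaussCode.IsEigenvaluePair
  rw [longitude_eq, map_pairLongitude, hρa, hρa', hρc', ← hL, ← hMv]
  exact ⟨hl, ha, hlL, haM⟩

theorem nonabelian_subset (n : ℤ) :
    (knot n).nonabelianEigenvaluePairs ⊆ (knot n).eigenvaluePairs := by
  rintro v ⟨ρ, -, h⟩
  exact ⟨ρ, h⟩

theorem mem_nonabelian_or {n : ℤ} {v : Fin 2 → ℂ} (hv : v ∈ (knot n).eigenvaluePairs) :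
    v ∈ (knot n).nonabelianEigenvaluePairs ∨ v 0 = 1 := by
  obtain ⟨ρ, hρ⟩ := hv
  by_cases h : ∃ g h, ρ g * ρ h ≠ ρ h * ρ g
  · exact Or.inl ⟨ρ, h, hρ⟩
  · right
    push Not at h
    have hl : ρ (knot n).longitude = 1 := by
      rw [longitude_eq, pairLongitude]
      generalize twistR (edge n 0) (edge n (k n)) ^ n = r
      generalize twistS (edge n 0) (edge n (k n)) ^ 2 = s
      have := h r s
      rw [map_mul, mul_assoc, map_mul, map_mul, map_inv, map_inv, mul_assoc, mul_assoc, this]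
      group
    rw [← hρ.2.2.1, hl]
    simp

theorem mem_eigenvaluePairs_of_one {n : ℤ} {v : Fin 2 → ℂ} (hL : v 0 = 1) (hM : v 1 ≠ 0) :
    v ∈ (knot n).eigenvaluePairs := by
  obtain ⟨a, ha⟩ : ∃ a : Matrix.SpecialLinearGroup (Fin 2) ℂ, a.1 = !![v 1, 0; 0, (v 1)⁻¹] :=
    ⟨⟨!![v 1, 0; 0, (v 1)⁻¹], by rw [Matrix.det_fin_two_of]; field_simp; ring⟩, rfl⟩
  have hr : twistR a a = 1 := by simp [twistR, twistS]
  obtain ⟨ρ, hρa, hρc⟩ := exists_hom n (a := a) (c := a) (by rw [hr]; simp)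
  have hρa' : ρ (edge n 0) = a := by rw [← meridian_eq, hρa]
  have hρc' : ρ (edge n (k n)) = a := hρc
  have hl : pairLongitude n a a = 1 := by simp [pairLongitude, twistS, hr]
  refine ⟨ρ, ?_⟩
  unfold SignedGaussCode.IsEigenvaluePair
  rw [longitude_eq, map_pairLongitude, hρa, hρa', hρc', hl, hL]
  refine ⟨by simp, by rw [ha]; simp, by simp, by rw [ha]; simp⟩

/-! ### Excluded lines and curves -/

theorem irreducible_X_sub_C (i : Fin 2) (ζ : ℂ) : Irreducible (X i - C ζ : MvPolynomial (Fin 2) ℂ) := by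
  have := irreducible_mul_X_add (1 : MvPolynomial (Fin 2) ℂ) (C (-ζ)) i one_ne_zero (by simp)
    (by simp) isRelPrime_one_left
  rwa [one_mul, map_neg, ← sub_eq_add_neg] at this

theorem irreducible_quadric : Irreducible (X 0 * X 1 ^ 2 + 1 : MvPolynomial (Fin 2) ℂ) := by
  have := irreducible_mul_X_add (X 1 ^ 2 : MvPolynomial (Fin 2) ℂ) 1 0 (by simp)
    (fun h => by simpa using vars_pow _ _ h) (by simp) isRelPrime_one_right
  rwa [mul_comm] at this

/-- Between irreducible polynomials divisibility is association, so `P` would divide `B` and `B`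
would vanish on the whole curve `P = 0`. -/
theorem not_dvd_of_eval {F P B : MvPolynomial (Fin 2) ℂ} (hF : Irreducible F) (hFB : F ∣ B)
    (hP : Irreducible P) (v : Fin 2 → ℂ) (hv : eval v P = 0) (hB : eval v B ≠ 0) : ¬ F ∣ P := by
  intro h
  obtain ⟨D, rfl⟩ := (hF.associated_of_dvd hP h).symm.dvd.trans hFB
  rw [map_mul, hv, zero_mul] at hB
  exact hB rfl

theorem X_sq_sub_one_eq (i : Fin 2) : (X i ^ 2 - 1 : MvPolynomial (Fin 2) ℂ) =
    (X i - C 1) * (X i - C (-1)) := by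
  simp only [map_neg, map_one]; ring

theorem X_sq_add_one_eq (i : Fin 2) : (X i ^ 2 + 1 : MvPolynomial (Fin 2) ℂ) =
    (X i - C Complex.I) * (X i - C (-Complex.I)) := by
  have h : (C Complex.I : MvPolynomial (Fin 2) ℂ) * C Complex.I = -1 := by
    rw [← C_mul, Complex.I_mul_I]; simp
  simp only [map_neg]
  linear_combination h

theorem eval_map_curvePoly (n : ℤ) (v : Fin 2 → ℂ) :
    eval v (map (Int.castRingHom ℂ) (curvePoly n)) = eliminant n (v 0) (v 1 ^ 2) := by
  rw [← aeval_curvePoly, eval_map, aeval_def]; rfl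

theorem eliminant_zero_one_complex (n : ℤ) : eliminant n (0 : ℂ) 1 = 1 := by
  have := map_eliminant (Int.castRingHom ℂ) n 0 1
  rw [eliminant_zero_one] at this
  simpa using this.symm

theorem exists_open_subset (n : ℤ) {F : MvPolynomial (Fin 2) ℂ} (hF : Irreducible F)
    (hFA : F ∣ map (Int.castRingHom ℂ) (curvePoly n)) :
    ∃ H, ¬ F ∣ H ∧ ∀ v, eval v F = 0 → eval v H ≠ 0 → v ∈ (knot n).nonabelianEigenvaluePairs := by
  -- The excluded curves are exactly those on which the construction of the representation may fail;
  -- each is ruled out as a component by one point with nonzero eliminant.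
  refine ⟨X 1 * (X 1 ^ 2 - 1) * (X 1 ^ 2 + 1) * (X 0 * X 1 ^ 2 + 1), ?_, ?_⟩
  · have hline : ∀ L ζ : ℂ, eliminant n L (ζ ^ 2) ≠ 0 → ¬ F ∣ X 1 - C ζ := fun L ζ h =>
      not_dvd_of_eval hF hFA (irreducible_X_sub_C 1 ζ) ![L, ζ] (by simp)
        (by rw [eval_map_curvePoly]; simpa using h)
    have h1 : (1 : ℂ) ^ 2 = 1 := by norm_num
    have h2 : (-1 : ℂ) ^ 2 = 1 := by norm_num
    have h3 : (-Complex.I) ^ 2 = -1 := by rw [neg_sq, Complex.I_sq]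
    rw [X_sq_sub_one_eq, X_sq_add_one_eq]
    intro h
    rcases hF.prime.dvd_or_dvd h with h | h
    · rcases hF.prime.dvd_or_dvd h with h | h
      · rcases hF.prime.dvd_or_dvd h with h | h
        · refine hline (5 / 2) 0 ?_ (by simpa using h)
          rw [zero_pow two_ne_zero]
          exact eliminant_right_zero n
        · rcases hF.prime.dvd_or_dvd h with h | h
          · exact hline 0 1 (by rw [h1, eliminant_zero_one_complex]; norm_num) h
          · exact hline 0 (-1) (by rw [h2, eliminant_zero_one_complex]; norm_num) h
      · rcases hF.prime.dvd_or_dvd h with h | h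
        · exact hline 0 Complex.I (by rw [Complex.I_sq]; exact eliminant_zero_neg_one n) h
        · exact hline 0 (-Complex.I) (by rw [h3]; exact eliminant_zero_neg_one n) h
    · obtain ⟨L, M, hQ, hne⟩ := exists_eliminant_degenerate n
      exact not_dvd_of_eval hF hFA irreducible_quadric ![L, M] (by simpa using hQ)
        (by rw [eval_map_curvePoly]; simpa using hne) h
  · intro v hv hH
    have hA : aeval v (curvePoly n) = 0 := by
      obtain ⟨D, hD⟩ := hFA
      rw [aeval_curvePoly, ← eval_map_curvePoly, hD, map_mul, hv, zero_mul]
    simp only [map_mul, map_sub, map_add, map_pow, eval_X, map_one] at hH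
    have hQ := right_ne_zero_of_mul hH
    have hH := left_ne_zero_of_mul hH
    exact mem_nonabelian_of_aeval hA (left_ne_zero_of_mul (left_ne_zero_of_mul hH))
      (right_ne_zero_of_mul (left_ne_zero_of_mul hH)) (right_ne_zero_of_mul hH) hQ

theorem X_sq_sub_one_ne_zero : (X 1 ^ 2 - 1 : MvPolynomial (Fin 2) ℂ) ≠ 0 := by
  intro h
  have := congrArg (eval ![0, 0]) h
  simp at this

theorem not_dvd_X_sq_sub_one {F : MvPolynomial (Fin 2) ℂ} (hF : Irreducible F)
    (h : F ∣ X 1 ^ 2 - 1) : ¬ F ∣ X 0 ^ 2 - 1 := by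
  intro h0
  rw [X_sq_sub_one_eq 1] at h
  rcases hF.prime.dvd_or_dvd h with h | h
  · exact not_dvd_of_eval hF h0 (irreducible_X_sub_C 1 1) ![0, 1] (by simp) (by simp) h
  · exact not_dvd_of_eval hF h0 (irreducible_X_sub_C 1 (-1)) ![0, -1] (by simp) (by simp) h

theorem definesCurvePart_nonabelian (n : ℤ) :
    DefinesCurvePart (knot n).nonabelianEigenvaluePairs (curvePoly n) := by
  refine definesCurvePart_of ⟨![0, 1], ?_⟩ X_sq_sub_one_ne_zero
    (fun F hF h => not_dvd_X_sq_sub_one hF h) (fun v hv => ?_)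
    fun F hF h => exists_open_subset n hF h
  · rw [aeval_curvePoly]
    simp [eliminant_zero_one]
  · simpa using aeval_of_mem_nonabelian hv

theorem definesCurvePart_all (n : ℤ) :
    DefinesCurvePart (knot n).eigenvaluePairs ((X 0 - 1) * curvePoly n) := by
  refine definesCurvePart_of ⟨![0, 1], ?_⟩ X_sq_sub_one_ne_zero
    (fun F hF h => not_dvd_X_sq_sub_one hF h) (fun v hv => ?_) fun F hF h => ?_
  · rw [map_mul, aeval_curvePoly]
    simp [eliminant_zero_one]
  · rcases mem_nonabelian_or hv with hv | hv
    · rcases aeval_of_mem_nonabelian hv with h | h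
      · left; rw [map_mul, h, mul_zero]
      · right; simpa using h
    · left; simp [hv]
  · rw [map_mul] at h
    rcases hF.prime.dvd_or_dvd h with h | h
    · have h' : F ∣ X 0 - C 1 := by simpa using h
      refine ⟨X 1, fun h1 => ?_, fun v hv hM => ?_⟩
      · exact not_dvd_of_eval hF h1 (irreducible_X_sub_C 0 1) ![1, 1] (by simp) (by simp) h'
      · obtain ⟨D, hD⟩ := h'
        have := congrArg (eval v) hD
        rw [map_mul, hv, zero_mul] at this
        refine mem_eigenvaluePairs_of_one ?_ (by simpa using hM)
        simpa [sub_eq_zero] using this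
    · obtain ⟨H, hH, hsub⟩ := exists_open_subset n hF h
      exact ⟨H, hH, fun v h1 h2 => nonabelian_subset n (hsub v h1 h2)⟩

theorem not_dvd_curvePoly {K : Type*} [CommRing K] {n : ℤ} {P : PolyLM} (v : Fin 2 → K)
    (hP : aeval v P = 0) (h : eliminant n (v 0) (v 1 ^ 2) ≠ 0) : ¬ P ∣ curvePoly n := by
  rintro ⟨D, hD⟩
  rw [← aeval_curvePoly, hD, map_mul, hP, zero_mul] at h
  exact h rfl

end ConwayKnot

end

theorem theorem1p1 (n : ℤ) :
    ∃ A : PolyLM,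
      -- `A = p_{2n}(u) p_{2n}(-u)`, whatever the choice of the square roots
      (∀ u r : AlgFun, u ^ 2 = uSquared Lfun Mfun → r ^ 2 = Lfun * Mfun ^ 2 + 1 →
        pFormula n Lfun Mfun r u * pFormula n Lfun Mfun r (-u) = algebraMap PolyLM AlgFun A) ∧
      -- up to repeated factors, `A` is the A-polynomial of `C(2n, 4)` without its factor `L - 1`
      DefinesCurvePart (ConwayKnot.knot n).nonabelianEigenvaluePairs A ∧
      -- and with the factor `L - 1` of the abelian representations
      DefinesCurvePart (ConwayKnot.knot n).eigenvaluePairs ((MvPolynomial.X 0 - 1) * A) ∧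
      -- there are no redundant factors
      ¬ (MvPolynomial.X 0 ∣ A) ∧ ¬ (MvPolynomial.X 1 ∣ A) ∧
      ¬ (MvPolynomial.X 0 * MvPolynomial.X 1 ^ 2 + 1 ∣ A) ∧
      ¬ (MvPolynomial.X 0 - 1 ∣ A) := by
  refine ⟨Riley.curvePoly n, fun u r hu hr => Riley.pFormula_mul_pFormula n hu hr,
    ConwayKnot.definesCurvePart_nonabelian n, ConwayKnot.definesCurvePart_all n, ?_, ?_, ?_, ?_⟩
  · exact ConwayKnot.not_dvd_curvePoly ![(0 : ℤ), 1] (by simp)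
      (by simp [Riley.eliminant_zero_one])
  · exact ConwayKnot.not_dvd_curvePoly ![(5 / 2 : ℂ), 0] (by simp)
      (by simpa using Riley.eliminant_right_zero n)
  · obtain ⟨L, M, hQ, hne⟩ := Riley.exists_eliminant_degenerate n
    exact ConwayKnot.not_dvd_curvePoly ![L, M] (by simpa using hQ) (by simpa using hne)
  · exact ConwayKnot.not_dvd_curvePoly ![(1 : ℤ), 1] (by simp)
      (by simpa using Riley.eliminant_one_one n)
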